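/- Let $p\ge 5$ be a prime and let $\mathcal Y=\mathbb P^1_{\mathbb Z_p}\smallsetminus\{0,1,\infty\}$, so that $\mathcal Y(\mathbb Z_p)=\{z\in\mathbb Z_p : z\in\mathbb Z_p^\times,\ 1-z\in\mathbb Z_p^\times\}$. Let $\log$ be the $p$-adic logarithm on $\mathbb Z_p^\times$, i.e. the homomorphism $\log(z)=\frac1{p-1}\sum_{n\ge1}\frac{(-1)^{n+1}}{n}(z^{p-1}-1)^n$. Let $\mathrm{Li}_k$ ($k\ge 0$) be the $p$-adic polylogarithms on $D=\{z\in\mathbb Z_p: 1-z\in\mathbb Z_p^\times\}$, i.e. the iterated Coleman integrals given by $\mathrm{Li}_0(z)=\frac z{1-z}$, $d\,\mathrm{Li}_k=\mathrm{Li}_{k-1}\frac{dz}{z}$ and $\mathrm{Li}_k(0)=0$ for $k\ge1$. Explicitly, for $k\ge 1$ the function $\mathrm{Li}_k$ has these properties, is given on every residue disc in $D$ by a power series converging on the open unit disc, and satisfies the following condition: for some polynomial $P\in\mathbb Q_p[T]$ none of whose roots in $\overline{\mathbb Q}_p$ is a root of unity, writing $\varphi(z)=z^p$, the function $P(\varphi^*)\mathrm{Li}_k$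 is overconvergent on $\mathbb P^1\smallsetminus\{1,\infty\}$, i.e. it is the sum of a power series in $z$ and a power series in $\frac1{1-z}$, both with coefficients in $\mathbb Q_p$ and with radius of convergence $>1$. Then $\mathrm{Li}_{p-3}$ is well defined by these conditions (it exists and is unique on $D$), and $z=-1$ is the one and only element $z\in\mathcal Y(\mathbb Z_p)$ satisfying $$\log(z)=0\quad\text{and}\quad \mathrm{Li}_{p-3}(z)=0 .$$ -/

import Mathlib

open Set Filter Topology Polynomial

/-- The `ℤ_p`-points of `ℙ¹ ∖ {0, 1, ∞}`: the `z ∈ ℤ_p` such that `z` and `1 - z` are units. -/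
def thricePuncturedLinePoints (p : ℕ) [Fact p.Prime] : Set ℤ_[p] :=
  {z | IsUnit z ∧ IsUnit (1 - z)}

/-- The `p`-adic logarithm on `p`-adic units: on `1 + pℤ_p` it is the usual series
`log x = -∑_{n ≥ 1} (1 - x)ⁿ / n`, and in general `log z = (p - 1)⁻¹ log (z ^ (p - 1))`. -/
noncomputable def padicLogUnit (p : ℕ) [Fact p.Prime] (z : ℚ_[p]) : ℚ_[p] :=
  ((p : ℚ_[p]) - 1)⁻¹ * -∑' n : ℕ, (1 - z ^ (p - 1)) ^ (n + 1) / ((n : ℚ_[p]) + 1)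

/-- The `ℤ_p`-points of the affine curve `ℙ¹ ∖ {1, ∞}` over `ℤ_p`, seen inside `ℚ_p`:
the union of the `ℚ_p`-rational residue discs other than those of `1` and `∞`. -/
def polylogDomain (p : ℕ) [Fact p.Prime] : Set ℚ_[p] :=
  {z | ‖z‖ ≤ 1 ∧ ‖1 - z‖ = 1}

/-- `h` is (on `ℤ_p`-points) an overconvergent function on `ℙ¹ ∖ {1, ∞}`, that is, an element of
the Monsky–Washnitzer algebra `ℚ_p⟨z, 1/(1-z)⟩†`: by partial fractions, a sum of a power series
in `z` and a power series in `1/(1-z)`, both with radius of convergence `> 1`. -/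
def IsOverconvergent (p : ℕ) [Fact p.Prime] (h : ℚ_[p] → ℚ_[p]) : Prop :=
  ∃ (a b : ℕ → ℚ_[p]) (ρ : ℝ), 1 < ρ ∧
    Tendsto (fun n => ‖a n‖ * ρ ^ n) atTop (𝓝 0) ∧
    Tendsto (fun n => ‖b n‖ * ρ ^ n) atTop (𝓝 0) ∧
    ∀ z ∈ polylogDomain p, HasSum (fun n => a n * z ^ n + b n * ((1 - z)⁻¹) ^ n) (h z)

/-- `P(φ^*) F` for a polynomial `P` and the lift of Frobenius `φ(z) = z ^ p`, that is, the function
`z ↦ ∑ Pᵢ F(z ^ (p ^ i))`. -/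
noncomputable def frobeniusPoly (p : ℕ) [Fact p.Prime] (P : ℚ_[p][X]) (F : ℚ_[p] → ℚ_[p]) :
    ℚ_[p] → ℚ_[p] :=
  fun z => P.sum fun i c => c * F (z ^ p ^ i)

/-- The two conditions of Coleman integration on `ℙ¹ ∖ {1, ∞}`: `F` is analytic on every (open)
residue disc, and `P(φ^*) F` is overconvergent for some polynomial `P` none of whose
roots is a root of unity. The second condition is what ties together the constants of integration
on the different residue discs. -/
structure IsColemanFunction (p : ℕ) [Fact p.Prime] (F : ℚ_[p] → ℚ_[p]) : Prop where
  analytic : ∀ a ∈ polylogDomain p,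
    ∃ q : FormalMultilinearSeries ℚ_[p] ℚ_[p] ℚ_[p], HasFPowerSeriesOnBall F q a 1
  frobenius : ∃ P : ℚ_[p][X],
    (∀ n : ℕ, 0 < n → ∀ ζ : PadicAlgCl p, ζ ^ n = 1 → aeval ζ P ≠ 0) ∧
      IsOverconvergent p (frobeniusPoly p P F)

/-- `F` is the `k`-th `p`-adic polylogarithm on `polylogDomain p`, i.e. the iterated Coleman
integral from `0` determined by `Li₀ = z / (1 - z)`, `d Li_k = Li_{k-1} dz / z` and
`Li_k(0) = 0` for `k ≥ 1`. -/
def IsPadicPolylog (p : ℕ) [Fact p.Prime] : ℕ → (ℚ_[p] → ℚ_[p]) → Prop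
  | 0, F => ∀ z ∈ polylogDomain p, F z = z / (1 - z)
  | k + 1, F => ∃ G : ℚ_[p] → ℚ_[p], IsPadicPolylog p k G ∧ IsColemanFunction p F ∧ F 0 = 0 ∧
      ∀ z ∈ polylogDomain p, z ≠ 0 → HasDerivAt F (G z / z) z

/-- The `k`-th `p`-adic polylogarithm `Li_k`. Its values are meaningful on `polylogDomain p`. -/
noncomputable def padicPolylog (p : ℕ) [Fact p.Prime] (k : ℕ) : ℚ_[p] → ℚ_[p] :=
  Classical.epsilon (IsPadicPolylog p k)

/-! Put $\mathrm{Li}_k^{(p)}(z)=\mathrm{Li}_k(z)-p^{-k}\mathrm{Li}_k(z^p)$. Formally this is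
$\sum_{p\nmid n}n^{-k}z^n$, and it extends to every residue disc of $D$ as the integral of
$x^{-k}1_{\mathbb Z_p^\times}$ against the distribution $a+p^N\mathbb Z_p\mapsto z^a/(1-z^{p^N})$,
that is, as `mahlerTransform (unitInvPow p k)`.

For units $z$ and $p\ge5$, $\log z=0$ forces $z^p=z$. Then $(1-p^{-k})\,\mathrm{Li}_k(z)$ is the
value of this integral. For $k=p-3$ the integrand is congruent to $x^2$ modulo $p$, so a zero gives
$\sum_{n<p}n^2z^n\equiv0$; in characteristic $p$ this says $(z-1)z(z+1)=0$ up to a cube of $z-1$,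
whence $z\equiv-1$, and $z=-1$ because Teichmüller points are determined by their residues.
Conversely $p-3$ is even, and the integral of an even function vanishing at $0$ is zero at $z=-1$
(`mahlerTransform_neg_one`).

Existence (`exists_isPadicPolylog`) is by induction on $k$: integrate disc by disc, with the
constants at Teichmüller points dictated by the Frobenius relation. Overconvergence amounts to
exponential decay of the Mahler coefficients of $x^{-k}1_{\mathbb Z_p^\times}$. Uniqueness
(`IsColemanFunction.eqOn`) holds because a difference of two candidates is constant on residue
discs, hence Frobenius invariant, and a nonzero multiple of it is a Tate function, which is constant
as soon as it is constant near $0$. -/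

/-! ### Power series on open unit discs and polynomial substitution -/

section PowerSeries

section Expansion

variable {K : Type*} [NormedField K]

/-- `F` is given on the open unit disc around `a` by the power series with coefficients `c`,
whose radius of convergence is at least `1`. -/
structure HasDiscExpansion (F : K → K) (a : K) (c : ℕ → K) : Prop where
  tendsto : ∀ r : ℝ, 0 < r → r < 1 → Tendsto (fun n => ‖c n‖ * r ^ n) atTop (𝓝 0)
  hasSum : ∀ h, ‖h‖ < 1 → HasSum (fun n => c n * h ^ n) (F (a + h))

namespace HasDiscExpansion

variable {F G : K → K} {a : K} {c d : ℕ → K}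

lemma add (hF : HasDiscExpansion F a c) (hG : HasDiscExpansion G a d) :
    HasDiscExpansion (fun z => F z + G z) a (fun n => c n + d n) where
  tendsto r h0 h1 := by
    refine squeeze_zero (fun n => by positivity) (fun n => ?_)
      (by simpa using (hF.tendsto r h0 h1).add (hG.tendsto r h0 h1))
    rw [← add_mul]
    have := norm_add_le (c n) (d n)
    gcongr
  hasSum h hh := by simpa [add_mul] using (hF.hasSum h hh).add (hG.hasSum h hh)

lemma const_mul (s : K) (hF : HasDiscExpansion F a c) :
    HasDiscExpansion (fun z => s * F z) a (fun n => s * c n) where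
  tendsto r h0 h1 := by
    simpa [mul_assoc] using (hF.tendsto r h0 h1).const_mul ‖s‖
  hasSum h hh := by simpa [mul_assoc] using (hF.hasSum h hh).mul_left s

lemma congr (hF : HasDiscExpansion F a c) (hFG : ∀ h, ‖h‖ < 1 → F (a + h) = G (a + h)) :
    HasDiscExpansion G a c :=
  ⟨hF.tendsto, fun h hh => hFG h hh ▸ hF.hasSum h hh⟩

lemma of_bounded {C : ℝ} (hc : ∀ n, ‖c n‖ ≤ C)
    (h : ∀ h, ‖h‖ < 1 → HasSum (fun n => c n * h ^ n) (F (a + h))) : HasDiscExpansion F a c where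
  tendsto r h0 h1 := by
    refine squeeze_zero (fun n => by positivity) (fun n => ?_)
      (by simpa using (tendsto_pow_atTop_nhds_zero_of_lt_one h0.le h1).const_mul C)
    have := hc n
    gcongr
  hasSum := h

lemma const (s a : K) : HasDiscExpansion (fun _ => s) a (fun n => if n = 0 then s else 0) := by
  refine of_bounded (C := ‖s‖) (fun n => ?_) fun h _ => ?_
  · split_ifs <;> simp
  · convert hasSum_ite_eq 0 s using 2 with n
    rcases eq_or_ne n 0 with rfl | hn <;> simp [*]

lemma apply_center (hF : HasDiscExpansion F a c) : F a = c 0 := by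
  have h := hF.hasSum 0 (by simp)
  rw [add_zero] at h
  refine h.unique ?_
  convert hasSum_ite_eq 0 (c 0) using 2 with n
  rcases eq_or_ne n 0 with rfl | hn <;> simp [*]

end HasDiscExpansion

end Expansion

variable {K : Type*} [NormedField K] [IsUltrametricDist K]

/-- Submultiplicativity of the Gauss norm of radius `r`. -/
lemma norm_coeff_pow_mul_le {Y : K[X]} {r R : ℝ} (hr : 0 ≤ r) (hR : 0 ≤ R)
    (hY : ∀ m, ‖Y.coeff m‖ * r ^ m ≤ R) (n m : ℕ) : ‖(Y ^ n).coeff m‖ * r ^ m ≤ R ^ n := by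
  induction n generalizing m with
  | zero =>
    rcases eq_or_ne m 0 with rfl | hm
    · simp
    · simp [coeff_one, hm]
  | succ n ih =>
    rw [pow_succ, coeff_mul]
    obtain ⟨x, hx, hle⟩ := IsUltrametricDist.exists_norm_finsetSum_le_of_nonempty
      (t := Finset.HasAntidiagonal.antidiagonal m) ⟨(0, m), by simp⟩
      (fun x => (Y ^ n).coeff x.1 * Y.coeff x.2)
    rw [Finset.HasAntidiagonal.mem_antidiagonal] at hx
    calc _ ≤ ‖(Y ^ n).coeff x.1 * Y.coeff x.2‖ * r ^ m := by gcongr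
      _ = (‖(Y ^ n).coeff x.1‖ * r ^ x.1) * (‖Y.coeff x.2‖ * r ^ x.2) := by
        rw [norm_mul, ← hx, pow_add]; ring
      _ ≤ R ^ n * R := by
        have := ih x.1
        have := hY x.2
        gcongr
      _ = _ := (pow_succ _ _).symm

/-- The coefficients of the expansion of `∑ cₙ Yⁿ` in powers of the variable of `Y`. -/
noncomputable def polyCompCoeff (c : ℕ → K) (Y : K[X]) (m : ℕ) : K :=
  ∑' n, c n * (Y ^ n).coeff m

lemma tendsto_polyCompCoeff {c : ℕ → K} {Y : K[X]} {r R : ℝ} (hr : 0 < r) (hR : 0 ≤ R)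
    (hY : ∀ m, ‖Y.coeff m‖ * r ^ m ≤ R) (hc : Tendsto (fun n => ‖c n‖ * R ^ n) atTop (𝓝 0)) :
    Tendsto (fun m => ‖polyCompCoeff c Y m‖ * r ^ m) atTop (𝓝 0) := by
  rw [Metric.tendsto_atTop] at hc ⊢
  intro ε hε
  obtain ⟨N, hN⟩ := hc (ε / 2) (by positivity)
  -- Beyond the degrees of all `Y ^ n` with `n < N`, only the small terms `n ≥ N` contribute.
  refine ⟨(Finset.range N).sup (fun n => (Y ^ n).natDegree) + 1, fun m hm => ?_⟩
  rw [Real.dist_eq, sub_zero, abs_of_nonneg (by positivity)]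
  refine lt_of_le_of_lt ?_ (half_lt_self hε)
  rw [← le_div_iff₀ (by positivity)]
  refine IsUltrametricDist.norm_tsum_le_of_forall_le_of_nonneg (by positivity) fun n => ?_
  rw [le_div_iff₀ (by positivity), norm_mul]
  rcases lt_or_ge n N with hn | hn
  · have h1 : (Y ^ n).natDegree < m := by
      refine lt_of_le_of_lt ?_ hm
      exact Finset.le_sup (f := fun n => (Y ^ n).natDegree) (Finset.mem_range.2 hn)
    rw [coeff_eq_zero_of_natDegree_lt h1]
    simp; positivity
  · have h2 := hN n hn
    rw [Real.dist_eq, sub_zero, abs_of_nonneg (by positivity)] at h2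
    have := norm_coeff_pow_mul_le hr.le hR hY n m
    calc _ = ‖c n‖ * (‖(Y ^ n).coeff m‖ * r ^ m) := by ring
      _ ≤ ‖c n‖ * R ^ n := by gcongr
      _ ≤ _ := h2.le

variable [CompleteSpace K]

/-- The terms of the double series tend to `0` along the cofinite filter; over a complete
ultrametric field this is summability, so the order of summation can be exchanged. -/
lemma hasSum_polyCompCoeff {c : ℕ → K} {Y : K[X]} {r R : ℝ} (hr : 0 < r) (hR : 0 ≤ R)
    (hY : ∀ m, ‖Y.coeff m‖ * r ^ m ≤ R) (hc : Tendsto (fun n => ‖c n‖ * R ^ n) atTop (𝓝 0))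
    {x s : K} (hx : ‖x‖ ≤ r) (hs : HasSum (fun n => c n * (Y.eval x) ^ n) s) :
    HasSum (fun m => polyCompCoeff c Y m * x ^ m) s := by
  have hterm (n m : ℕ) : ‖c n * (Y ^ n).coeff m * x ^ m‖ ≤ ‖c n‖ * R ^ n := by
    rw [norm_mul, norm_mul, norm_pow]
    calc _ ≤ ‖c n‖ * ‖(Y ^ n).coeff m‖ * r ^ m := by gcongr
      _ = ‖c n‖ * (‖(Y ^ n).coeff m‖ * r ^ m) := by ring
      _ ≤ _ := by
        have := norm_coeff_pow_mul_le hr.le hR hY n m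
        gcongr
  have hsum : Summable fun q : ℕ × ℕ => c q.1 * (Y ^ q.1).coeff q.2 * x ^ q.2 := by
    apply NonarchimedeanAddGroup.summable_of_tendsto_cofinite_zero
    rw [Metric.tendsto_nhds]
    intro ε hε
    obtain ⟨N, hN⟩ := (Metric.tendsto_atTop.1 hc) ε hε
    rw [eventually_cofinite]
    refine ((Finset.range N ×ˢ Finset.range ((Finset.range N).sup
      (fun n => (Y ^ n).natDegree) + 1)).finite_toSet).subset ?_
    rintro ⟨n, m⟩ hnm
    simp only [dist_zero_right, not_lt, mem_ofPred_eq] at hnm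
    have hn : n < N := by
      by_contra! hn
      have := hN n hn
      rw [Real.dist_eq, sub_zero, abs_of_nonneg (by positivity)] at this
      linarith [hterm n m]
    simp only [Finset.coe_product, mem_prod, Finset.mem_coe, Finset.mem_range]
    refine ⟨hn, ?_⟩
    by_contra! hm
    have h1 : (Y ^ n).natDegree < m := by
      refine lt_of_le_of_lt ?_ hm
      exact Finset.le_sup (f := fun n => (Y ^ n).natDegree) (Finset.mem_range.2 hn)
    rw [coeff_eq_zero_of_natDegree_lt h1] at hnm
    simp at hnm
    linarith
  have h1 : HasSum (fun n => c n * (Y.eval x) ^ n)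
      (∑' q : ℕ × ℕ, c q.1 * (Y ^ q.1).coeff q.2 * x ^ q.2) := by
    refine hsum.hasSum.prod_fiberwise fun n => ?_
    rw [← eval_pow, eval_eq_sum_range, Finset.mul_sum]
    simp_rw [← mul_assoc]
    refine hasSum_sum_of_ne_finset_zero fun m hm => ?_
    rw [coeff_eq_zero_of_natDegree_lt (by simpa using hm)]
    simp
  rw [hs.unique h1]
  refine ((Equiv.prodComm ℕ ℕ).hasSum_iff.2 hsum.hasSum).prod_fiberwise fun m => ?_
  refine HasSum.mul_right _ ?_
  refine (NonarchimedeanAddGroup.summable_of_tendsto_cofinite_zero ?_).hasSum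
  rw [Nat.cofinite_eq_atTop]
  refine squeeze_zero_norm (a := fun n => (‖c n‖ * R ^ n) / r ^ m) (fun n => ?_)
    (by simpa using hc.div_const (r ^ m))
  change ‖c n * (Y ^ n).coeff m‖ ≤ _
  rw [le_div_iff₀ (by positivity), norm_mul]
  have := norm_coeff_pow_mul_le hr.le hR hY n m
  calc _ = ‖c n‖ * (‖(Y ^ n).coeff m‖ * r ^ m) := by ring
    _ ≤ ‖c n‖ * R ^ n := by gcongr

namespace HasDiscExpansion

variable {F : K → K} {a : K} {c : ℕ → K}

/-- Composition with a polynomial that maps the open unit disc around `b` to the one around `a`. -/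
lemma comp_polynomial (hF : HasDiscExpansion F a c) {Q Y : K[X]} {b : K} (hY : ∀ m, ‖Y.coeff m‖ ≤ 1)
    (hY0 : ‖Y.coeff 0‖ < 1) (hQ : ∀ h, Q.eval (b + h) = a + Y.eval h) :
    HasDiscExpansion (fun z => F (Q.eval z)) b (polyCompCoeff c Y) := by
  have key (r : ℝ) (h0 : 0 < r) (h1 : r < 1) :
      ∃ R, r ≤ R ∧ 0 < R ∧ R < 1 ∧ ∀ m, ‖Y.coeff m‖ * r ^ m ≤ R := by
    -- The constant coefficient is the only one not shrunk by a power of `r`.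
    refine ⟨max r ‖Y.coeff 0‖, le_max_left _ _, lt_max_of_lt_left h0, max_lt h1 hY0, fun m => ?_⟩
    rcases m with _ | m
    · simp
    · refine le_trans ?_ (le_max_left _ _)
      calc _ ≤ 1 * r ^ (m + 1) := by gcongr; exact hY _
        _ = r ^ m * r := by ring
        _ ≤ 1 * r := by gcongr; exact pow_le_one₀ h0.le h1.le
        _ = r := one_mul _
  have hball (h : K) (hh : ‖h‖ < 1) : ‖Y.eval h‖ < 1 := by
    -- The `1 / 2` only keeps the radius positive when `h = 0`.
    obtain ⟨R, -, -, hR1, hR⟩ := key (max ‖h‖ (1 / 2)) (by positivity) (max_lt hh (by norm_num))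
    refine lt_of_le_of_lt ?_ hR1
    rw [eval_eq_sum_range]
    refine IsUltrametricDist.norm_sum_le_of_forall_le_of_nonempty ⟨0, by simp⟩ fun i _ => ?_
    refine le_trans ?_ (hR i)
    rw [norm_mul, norm_pow]
    gcongr
    exact le_max_left _ _
  constructor
  · intro r h0 h1
    obtain ⟨R, -, hR0, hR1, hR⟩ := key r h0 h1
    exact tendsto_polyCompCoeff h0 hR0.le hR (hF.tendsto R hR0 hR1)
  · intro h hh
    obtain ⟨R, -, hR0, hR1, hR⟩ := key (max ‖h‖ (1 / 2)) (by positivity) (max_lt hh (by norm_num))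
    refine hasSum_polyCompCoeff (by positivity) hR0.le hR (hF.tendsto R hR0 hR1)
      (le_max_left _ _) ?_
    simp only [hQ]
    exact hF.hasSum _ (hball h hh)

lemma recenter (hF : HasDiscExpansion F a c) {b : K} (hb : ‖b - a‖ < 1) :
    HasDiscExpansion F b (polyCompCoeff c (X + C (b - a))) := by
  have := hF.comp_polynomial (Q := X) (Y := X + C (b - a)) (b := b) ?_ ?_ ?_
  · simpa using this
  · intro m
    rw [coeff_add, coeff_X, coeff_C]
    rcases m with _ | _ | m <;> simp [hb.le]
  · simpa using hb
  · intro h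
    simp only [eval_X, eval_add, eval_C]
    ring

end HasDiscExpansion

end PowerSeries

/-! ### Derivatives, products and primitives of disc expansions -/

lemma mem_eball_zero_one_iff {K : Type*} [NormedField K] {y : K} :
    y ∈ Metric.eball (0 : K) 1 ↔ ‖y‖ < 1 := by
  rw [Metric.mem_eball, edist_zero_right, ← ofReal_norm, ENNReal.ofReal_lt_one]

namespace HasDiscExpansion

section Calculus

variable {K : Type*} [NontriviallyNormedField K] {F G : K → K} {a : K} {c d : ℕ → K}

lemma summable_norm (hF : HasDiscExpansion F a c) {r : ℝ} (h0 : 0 ≤ r) (h1 : r < 1) :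
    Summable fun n => ‖c n‖ * r ^ n := by
  obtain ⟨s, hs, hs1⟩ := exists_between h1
  have hs0 : 0 < s := h0.trans_lt hs
  obtain ⟨C, hC⟩ := (hF.tendsto s hs0 hs1).bddAbove_range
  refine Summable.of_nonneg_of_le (fun n => by positivity) (fun n => ?_)
    ((summable_geometric_of_lt_one (div_nonneg h0 hs0.le) ((div_lt_one hs0).2 hs)).mul_left C)
  calc ‖c n‖ * r ^ n = ‖c n‖ * s ^ n * (r / s) ^ n := by
        rw [div_pow]; field_simp
    _ ≤ C * (r / s) ^ n := by
        gcongr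
        exact hC ⟨n, rfl⟩

lemma hasFPowerSeriesOnBall (hF : HasDiscExpansion F a c) :
    HasFPowerSeriesOnBall F (FormalMultilinearSeries.ofScalars K c) a 1 where
  r_le := by
    refine ENNReal.le_of_forall_nnreal_lt fun r hr => ?_
    refine FormalMultilinearSeries.le_radius_of_summable_norm _ ?_
    simp only [FormalMultilinearSeries.ofScalars_norm]
    exact hF.summable_norm r.2 (by exact_mod_cast hr)
  r_pos := one_pos
  hasSum {y} hy := by
    have := mem_eball_zero_one_iff.1 hy
    simpa [mul_comm] using hF.hasSum y this

lemma of_hasFPowerSeriesOnBall {q : FormalMultilinearSeries K K K}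
    (hF : HasFPowerSeriesOnBall F q a 1) : HasDiscExpansion F a q.coeff where
  tendsto r h0 h1 := by
    have : ((NNReal.mk r h0.le : NNReal) : ENNReal) < q.radius :=
      lt_of_lt_of_le (by exact_mod_cast h1) hF.r_le
    simpa using (q.summable_norm_mul_pow this).tendsto_atTop_zero
  hasSum h hh := by
    have := hF.hasSum (y := h) (mem_eball_zero_one_iff.2 hh)
    simpa [mul_comm] using this

lemma hasDerivAt [CompleteSpace K] (hF : HasDiscExpansion F a c) {h : K} (hh : ‖h‖ < 1) :
    ∃ s, HasDerivAt F s (a + h) ∧ HasSum (fun n => ((n + 1 : ℕ) * c (n + 1)) * h ^ n) s := by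
  have hq := hF.hasFPowerSeriesOnBall
  have hmem : h ∈ Metric.eball (0 : K) 1 := mem_eball_zero_one_iff.2 hh
  have hd : DifferentiableAt K F (a + h) := by
    refine (hq.differentiableOn.differentiableAt (Metric.isOpen_eball.mem_nhds ?_))
    simpa [Metric.mem_eball, edist_eq_enorm_sub] using hmem
  refine ⟨_, hd.hasDerivAt, ?_⟩
  have := (hq.fderiv.hasSum hmem).mapL (ContinuousLinearMap.apply K K (1 : K))
  simp only [ContinuousLinearMap.apply_apply, fderiv_apply_one_eq_deriv,
    FormalMultilinearSeries.apply_eq_pow_smul_coeff, smul_apply,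
    FormalMultilinearSeries.derivSeries_coeff_one, FormalMultilinearSeries.coeff_ofScalars] at this
  refine this.congr_fun fun n => ?_
  simp [mul_comm]

/-- The point `0` is exempted because the differential equation of polylogarithms divides by `z`.
Zeros of a nonzero analytic function are isolated, so the derivative vanishes near `a` all the same,
and all higher coefficients are zero. -/
lemma eq_center_of_hasDerivAt_zero [CompleteSpace K] [CharZero K] (hF : HasDiscExpansion F a c)
    (hd : ∀ h, ‖h‖ < 1 → a + h ≠ 0 → HasDerivAt F 0 (a + h)) {h : K} (hh : ‖h‖ < 1) :
    F (a + h) = F a := by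
  have hq := hF.hasFPowerSeriesOnBall.hasFPowerSeriesAt
  have hD : AnalyticAt K (deriv F) a := AnalyticAt.deriv ⟨_, hq⟩
  have hzero : ∀ᶠ z in 𝓝[≠] a, deriv F z = 0 := by
    have h1 : ∀ᶠ z in 𝓝[≠] a, z ≠ 0 := by
      rcases eq_or_ne a 0 with rfl | ha
      · exact eventually_mem_nhdsWithin
      · exact eventually_nhdsWithin_of_eventually_nhds (eventually_ne_nhds ha)
    have h2 : ∀ᶠ z in 𝓝[≠] a, z ∈ Metric.ball a 1 :=
      eventually_nhdsWithin_of_eventually_nhds (Metric.ball_mem_nhds a one_pos)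
    filter_upwards [h1, h2] with z hz0 hz1
    have := hd (z - a) (by simpa [dist_eq_norm] using hz1) (by simpa using hz0)
    simpa using this.deriv
  have hev : deriv F =ᶠ[𝓝 a] 0 := by
    rcases hD.eventually_eq_zero_or_eventually_ne_zero with h | h
    · exact h
    · obtain ⟨z, hz⟩ := (hzero.and h).exists
      exact absurd hz.1 hz.2
  have hcoeff (n : ℕ) : c (n + 1) = 0 := by
    have h1 := hF.hasFPowerSeriesOnBall.fderiv.hasFPowerSeriesAt
    have h2 : fderiv K F =ᶠ[𝓝 a] 0 := by
      filter_upwards [hev] with z hz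
      ext
      simpa using hz
    have h3 := FormalMultilinearSeries.derivSeries_coeff_one
      (FormalMultilinearSeries.ofScalars K c) n
    rw [(h1.congr h2).eq_zero] at h3
    simp only [FormalMultilinearSeries.coeff] at h3
    simpa [Nat.cast_add_one_ne_zero] using h3.symm
  rw [hF.apply_center]
  refine (hF.hasSum h hh).unique ?_
  convert hasSum_single (f := fun n => c n * h ^ n) 0 fun n hn => ?_
  · simp
  · obtain ⟨m, rfl⟩ := Nat.exists_eq_succ_of_ne_zero hn
    simp [hcoeff]

lemma coeff_unique (hF : HasDiscExpansion F a c) (hF' : HasDiscExpansion F a d) : c = d :=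
  FormalMultilinearSeries.ofScalars_series_injective K K <|
    hF.hasFPowerSeriesOnBall.hasFPowerSeriesAt.eq_formalMultilinearSeries
      hF'.hasFPowerSeriesOnBall.hasFPowerSeriesAt

lemma mul [CompleteSpace K] (hF : HasDiscExpansion F a c) (hG : HasDiscExpansion G a d) :
    HasDiscExpansion (fun z => F z * G z) a
      (fun n => ∑ q ∈ Finset.HasAntidiagonal.antidiagonal n, c q.1 * d q.2) where
  tendsto r h0 h1 := by
    have h2 := (summable_norm_sum_mul_antidiagonal_of_summable_norm
      (hF.summable_norm h0.le h1).norm (hG.summable_norm h0.le h1).norm).tendsto_atTop_zero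
    refine squeeze_zero (fun n => by positivity) (fun n => ?_) h2
    rw [Real.norm_eq_abs, abs_of_nonneg (Finset.sum_nonneg fun q _ => by positivity)]
    refine (mul_le_mul_of_nonneg_right (norm_sum_le _ _) (by positivity)).trans_eq ?_
    rw [Finset.sum_mul]
    refine Finset.sum_congr rfl fun q hq => ?_
    rw [← Finset.HasAntidiagonal.mem_antidiagonal.1 hq, norm_mul, pow_add]
    ring
  hasSum h hh := by
    have hf := hF.summable_norm (norm_nonneg h) hh
    have hg := hG.summable_norm (norm_nonneg h) hh
    simp only [← norm_pow, ← norm_mul] at hf hg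
    rw [← (hF.hasSum h hh).tsum_eq, ← (hG.hasSum h hh).tsum_eq,
      tsum_mul_tsum_eq_tsum_sum_antidiagonal_of_summable_norm hf hg]
    refine (summable_norm_sum_mul_antidiagonal_of_summable_norm hf hg).of_norm.hasSum.congr_fun
      fun n => ?_
    rw [Finset.sum_mul]
    refine Finset.sum_congr rfl fun q hq => ?_
    rw [← Finset.HasAntidiagonal.mem_antidiagonal.1 hq, pow_add]
    ring

lemma inv_id [CompleteSpace K] (ha : ‖a‖ = 1) :
    HasDiscExpansion (fun z => z⁻¹) a (fun n => a⁻¹ * (-a⁻¹) ^ n) := by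
  have ha0 : a ≠ 0 := norm_ne_zero_iff.1 (by simp [ha])
  refine of_bounded (C := 1) (fun n => by simp [ha]) fun h hh => ?_
  have h1 : ‖-a⁻¹ * h‖ < 1 := by simpa [ha] using hh
  have h2 := (hasSum_geometric_of_norm_lt_one h1).mul_left a⁻¹
  have : a⁻¹ * (1 - -a⁻¹ * h)⁻¹ = (a + h)⁻¹ := by
    rw [← mul_inv]
    congr 1
    field_simp
    ring
  rw [this] at h2
  refine h2.congr_fun fun n => ?_
  rw [mul_pow]
  ring

end Calculus

section Padic

variable {p : ℕ} [Fact p.Prime] {F G : ℚ_[p] → ℚ_[p]} {a : ℚ_[p]} {c : ℕ → ℚ_[p]}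

-- On the disc of `0`, division by `z` shifts the coefficients, and the value at `0` has to be
-- redefined as `c 1`; on other discs `z⁻¹` is itself analytic.
open Classical in
lemma exists_div_id (hG : HasDiscExpansion G a c) (ha : a = 0 ∧ G 0 = 0 ∨ ‖a‖ = 1) :
    ∃ (H : ℚ_[p] → ℚ_[p]) (d : ℕ → ℚ_[p]), HasDiscExpansion H a d ∧
      ∀ z, z ≠ 0 → H z = G z / z := by
  rcases ha with ⟨rfl, h0⟩ | ha
  · refine ⟨fun z => if z = 0 then c 1 else G z / z, fun n => c (n + 1), ⟨fun r hr0 hr1 => ?_,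
      fun h hh => ?_⟩, fun z hz => if_neg hz⟩
    · have := ((tendsto_add_atTop_iff_nat 1).2 (hG.tendsto r hr0 hr1)).div_const r
      rw [zero_div] at this
      refine this.congr fun n => ?_
      rw [pow_succ]
      field_simp
    · rw [zero_add]
      have hc0 : c 0 = 0 := by rw [← hG.apply_center, h0]
      split_ifs with hz
      · subst hz
        convert hasSum_single (f := fun n => c (n + 1) * (0 : ℚ_[p]) ^ n) 0 fun n hn => ?_
        · simp
        · simp [hn]
      · have := hG.hasSum h hh
        rw [← hasSum_nat_add_iff' 1] at this
        simp only [Finset.range_one, Finset.sum_singleton, hc0, zero_mul, sub_zero, zero_add]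
          at this
        refine (this.div_const h).congr_fun fun n => ?_
        rw [pow_succ]
        field_simp
  · exact ⟨_, _, hG.mul (inv_id ha), fun z _ => (div_eq_mul_inv _ _).symm⟩

lemma norm_inv_natCast_le {n : ℕ} (hn : n ≠ 0) : ‖(n : ℚ_[p])⁻¹‖ ≤ n := by
  rw [norm_inv, Padic.norm_eq_zpow_neg_valuation (by exact_mod_cast hn), Padic.valuation_natCast,
    ← zpow_neg, neg_neg, zpow_natCast]
  exact_mod_cast Nat.le_of_dvd (Nat.pos_of_ne_zero hn) pow_padicValNat_dvd

/-- Termwise integration. The denominators satisfy `‖(n : ℚ_[p])⁻¹‖ ≤ n`, and this linear growth is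
absorbed by passing to a slightly larger radius `t < 1`. -/
lemma exists_primitive (hG : HasDiscExpansion G a c) (s : ℚ_[p]) :
    ∃ (F : ℚ_[p] → ℚ_[p]) (d : ℕ → ℚ_[p]), HasDiscExpansion F a d ∧ F a = s ∧
      ∀ h, ‖h‖ < 1 → HasDerivAt F (G (a + h)) (a + h) := by
  let d : ℕ → ℚ_[p] := fun n => if n = 0 then s else ((n : ℕ) : ℚ_[p])⁻¹ * c (n - 1)
  have hd0 : d 0 = s := rfl
  have hd (n : ℕ) : d (n + 1) = ((n + 1 : ℕ) : ℚ_[p])⁻¹ * c n := rfl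
  have hnorm (r : ℝ) (h0 : 0 ≤ r) (h1 : r < 1) : Tendsto (fun n => ‖d n‖ * r ^ n) atTop (𝓝 0) := by
    obtain ⟨t, ht, ht1⟩ := exists_between h1
    have ht0 : 0 < t := h0.trans_lt ht
    rw [← tendsto_add_atTop_iff_nat 1]
    have h2 : Tendsto (fun n : ℕ => (n + 1 : ℝ) * (r / t) ^ n) atTop (𝓝 0) := by
      have h3 := tendsto_self_mul_const_pow_of_lt_one (div_nonneg h0 ht0.le) ((div_lt_one ht0).2 ht)
      have h4 := tendsto_pow_atTop_nhds_zero_of_lt_one (div_nonneg h0 ht0.le)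
        ((div_lt_one ht0).2 ht)
      simpa [add_mul] using h3.add h4
    have h5 := (h2.mul (hG.tendsto t ht0 ht1)).mul_const r
    rw [mul_zero, zero_mul] at h5
    refine squeeze_zero (fun n => by positivity) (fun n => ?_) h5
    rw [hd, norm_mul]
    calc _ ≤ ((n + 1 : ℕ) : ℝ) * ‖c n‖ * r ^ (n + 1) := by
          gcongr
          exact norm_inv_natCast_le n.succ_ne_zero
      _ = _ := by
          rw [div_pow, pow_succ]
          push_cast
          field_simp
  let F : ℚ_[p] → ℚ_[p] := fun z => ∑' n, d n * (z - a) ^ n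
  have hF : HasDiscExpansion F a d := by
    refine ⟨fun r h0 h1 => hnorm r h0.le h1, fun h hh => ?_⟩
    simp only [F, add_sub_cancel_left]
    refine (NonarchimedeanAddGroup.summable_of_tendsto_cofinite_zero ?_).hasSum
    rw [Nat.cofinite_eq_atTop, tendsto_zero_iff_norm_tendsto_zero]
    simpa using hnorm ‖h‖ (norm_nonneg h) hh
  refine ⟨F, d, hF, by rw [hF.apply_center, hd0], fun h hh => ?_⟩
  obtain ⟨s', h1, h2⟩ := hF.hasDerivAt hh
  suffices G (a + h) = s' from this ▸ h1
  refine (hG.hasSum h hh).unique (h2.congr_fun fun n => ?_)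
  rw [hd]
  have : ((n + 1 : ℕ) : ℚ_[p]) ≠ 0 := by exact_mod_cast n.succ_ne_zero
  field_simp

end Padic

end HasDiscExpansion

/-! ### Mahler coefficients and integration against $z^a/(1-z^{p^N})$ -/

section MahlerTransform

variable {p : ℕ} [Fact p.Prime]

instance PadicInt.isBoundedSMul_padic : IsBoundedSMul ℤ_[p] ℚ_[p] :=
  IsBoundedSMul.of_norm_smul_le fun r x => (norm_mul (r : ℚ_[p]) x).le

/-- The Mahler coefficients of a continuous function on `ℤ_p`. -/
noncomputable def mahlerCoeff (f : C(ℤ_[p], ℚ_[p])) (n : ℕ) : ℚ_[p] := (fwdDiff 1)^[n] f 0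

/-- The integral of `f` against the distribution `a + p ^ N ℤ_p ↦ z ^ a / (1 - z ^ (p ^ N))`. -/
noncomputable def mahlerTransform (f : C(ℤ_[p], ℚ_[p])) (z : ℚ_[p]) : ℚ_[p] :=
  ∑' n, mahlerCoeff f n * ((1 - z)⁻¹ * (z * (1 - z)⁻¹) ^ n)

/-- The shiftMap `x ↦ f (x + a)`. -/
noncomputable def shiftMap (a : ℤ_[p]) (f : C(ℤ_[p], ℚ_[p])) : C(ℤ_[p], ℚ_[p]) :=
  ⟨fun x => f (x + a), by fun_prop⟩

@[simp] lemma shiftMap_apply (a x : ℤ_[p]) (f : C(ℤ_[p], ℚ_[p])) : shiftMap a f x = f (x + a) :=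
  rfl

lemma norm_mahlerCoeff_le (f : C(ℤ_[p], ℚ_[p])) (n : ℕ) : ‖mahlerCoeff f n‖ ≤ ‖f‖ :=
  IsUltrametricDist.norm_fwdDiff_iter_apply_le 1 f 0 n

lemma tendsto_mahlerCoeff (f : C(ℤ_[p], ℚ_[p])) : Tendsto (mahlerCoeff f) atTop (𝓝 0) :=
  PadicInt.fwdDiff_tendsto_zero f

@[simp] lemma mahlerCoeff_zero (f : C(ℤ_[p], ℚ_[p])) : mahlerCoeff f 0 = f 0 := rfl

lemma mahlerCoeff_add (f g : C(ℤ_[p], ℚ_[p])) (n : ℕ) :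
    mahlerCoeff (f + g) n = mahlerCoeff f n + mahlerCoeff g n := by
  simp only [mahlerCoeff, ContinuousMap.coe_add, fwdDiff_iter_add]
  rfl

lemma mahlerCoeff_smul (c : ℚ_[p]) (f : C(ℤ_[p], ℚ_[p])) (n : ℕ) :
    mahlerCoeff (c • f) n = c * mahlerCoeff f n := by
  simp only [mahlerCoeff, ContinuousMap.coe_smul, fwdDiff_iter_const_smul]
  rfl

lemma fwdDiff_iter_apply_add_one (f : ℤ_[p] → ℚ_[p]) (n : ℕ) (x : ℤ_[p]) :
    (fwdDiff 1)^[n] f (x + 1) = (fwdDiff 1)^[n] f x + (fwdDiff 1)^[n + 1] f x := by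
  rw [Function.iterate_succ_apply', fwdDiff]
  ring

lemma mahlerCoeff_shiftMap_one (f : C(ℤ_[p], ℚ_[p])) (n : ℕ) :
    mahlerCoeff (shiftMap 1 f) n = mahlerCoeff f n + mahlerCoeff f (n + 1) := by
  have := fwdDiff_iter_comp_add (1 : ℤ_[p]) f 1 n 0
  exact this.trans (fwdDiff_iter_apply_add_one _ _ _)

variable {z : ℚ_[p]}

lemma norm_inv_one_sub (hz : z ∈ polylogDomain p) : ‖(1 - z)⁻¹‖ = 1 := by
  rw [norm_inv, hz.2, inv_one]

lemma one_sub_ne_zero_of_mem (hz : z ∈ polylogDomain p) : 1 - z ≠ 0 :=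
  norm_ne_zero_iff.1 (by simp [hz.2])

lemma norm_mul_inv_one_sub_le (hz : z ∈ polylogDomain p) : ‖z * (1 - z)⁻¹‖ ≤ 1 := by
  rw [norm_mul, norm_inv_one_sub hz, mul_one]
  exact hz.1

lemma norm_mahlerTransform_term_le (f : C(ℤ_[p], ℚ_[p])) (hz : z ∈ polylogDomain p) (n : ℕ) :
    ‖mahlerCoeff f n * ((1 - z)⁻¹ * (z * (1 - z)⁻¹) ^ n)‖ ≤ ‖mahlerCoeff f n‖ := by
  rw [norm_mul, norm_mul, norm_inv_one_sub hz, one_mul, norm_pow]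
  exact mul_le_of_le_one_right (norm_nonneg _)
    (pow_le_one₀ (norm_nonneg _) (norm_mul_inv_one_sub_le hz))

lemma hasSum_mahlerTransform (f : C(ℤ_[p], ℚ_[p])) (hz : z ∈ polylogDomain p) :
    HasSum (fun n => mahlerCoeff f n * ((1 - z)⁻¹ * (z * (1 - z)⁻¹) ^ n))
      (mahlerTransform f z) := by
  refine (NonarchimedeanAddGroup.summable_of_tendsto_cofinite_zero ?_).hasSum
  rw [Nat.cofinite_eq_atTop]
  exact squeeze_zero_norm (norm_mahlerTransform_term_le f hz)
    (tendsto_zero_iff_norm_tendsto_zero.1 (tendsto_mahlerCoeff f))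

lemma norm_mahlerTransform_le (f : C(ℤ_[p], ℚ_[p])) (hz : z ∈ polylogDomain p) :
    ‖mahlerTransform f z‖ ≤ ‖f‖ :=
  IsUltrametricDist.norm_tsum_le_of_forall_le fun n =>
    (norm_mahlerTransform_term_le f hz n).trans (norm_mahlerCoeff_le f n)

lemma mahlerTransform_add (f g : C(ℤ_[p], ℚ_[p])) (hz : z ∈ polylogDomain p) :
    mahlerTransform (f + g) z = mahlerTransform f z + mahlerTransform g z := by
  refine (hasSum_mahlerTransform _ hz).unique ?_
  simpa only [mahlerCoeff_add, add_mul] using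
    (hasSum_mahlerTransform f hz).add (hasSum_mahlerTransform g hz)

lemma mahlerTransform_smul (c : ℚ_[p]) (f : C(ℤ_[p], ℚ_[p])) (hz : z ∈ polylogDomain p) :
    mahlerTransform (c • f) z = c * mahlerTransform f z := by
  refine (hasSum_mahlerTransform _ hz).unique ?_
  simpa only [mahlerCoeff_smul, mul_assoc] using (hasSum_mahlerTransform f hz).mul_left c

lemma mahlerTransform_sub (f g : C(ℤ_[p], ℚ_[p])) (hz : z ∈ polylogDomain p) :
    mahlerTransform (f - g) z = mahlerTransform f z - mahlerTransform g z := by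
  have := mahlerTransform_add (f - g) g hz
  rw [sub_add_cancel] at this
  rw [this, add_sub_cancel_right]

/-- Formally the transform is $\sum f(n)z^n$, and this splits off the first term. Deducing it from
`mahlerCoeff_shiftMap_one` makes it valid also where that series diverges. -/
lemma mahlerTransform_eq_add_shiftMap_one (f : C(ℤ_[p], ℚ_[p])) (hz : z ∈ polylogDomain p) :
    mahlerTransform f z = f 0 + z * mahlerTransform (shiftMap 1 f) z := by
  have h0 := one_sub_ne_zero_of_mem hz
  have h1 := (hasSum_mahlerTransform f hz).mul_left (1 - z)
  have h2 := (hasSum_mahlerTransform (shiftMap 1 f) hz).mul_left z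
  have h3 := (hasSum_nat_add_iff' 1).2 h1
  have h4 := ((h1.mul_left (z * (1 - z)⁻¹)).add h3).unique (h2.congr_fun fun n => ?_)
  · simp only [Finset.range_one, Finset.sum_singleton, mahlerCoeff_zero, pow_zero, mul_one] at h4
    field_simp at h4
    linear_combination h4
  · rw [mahlerCoeff_shiftMap_one, pow_succ]
    field_simp

lemma shiftMap_shiftMap (a b : ℤ_[p]) (f : C(ℤ_[p], ℚ_[p])) :
    shiftMap a (shiftMap b f) = shiftMap (a + b) f := by
  ext x
  simp [add_assoc]

lemma mahlerTransform_eq_sum_add (f : C(ℤ_[p], ℚ_[p])) (hz : z ∈ polylogDomain p) (N : ℕ) :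
    mahlerTransform f z =
      ∑ n ∈ Finset.range N, f n * z ^ n + z ^ N * mahlerTransform (shiftMap N f) z := by
  induction N with
  | zero =>
    have : shiftMap (0 : ℤ_[p]) f = f := by ext; simp
    simp [this]
  | succ N ih =>
    rw [ih, mahlerTransform_eq_add_shiftMap_one (shiftMap N f) hz, shiftMap_shiftMap,
      Finset.sum_range_succ, shiftMap_apply, zero_add, Nat.cast_succ, add_comm (1 : ℤ_[p])]
    ring

lemma PadicInt.norm_lt_one_iff_toZMod_eq_zero {x : ℤ_[p]} : ‖x‖ < 1 ↔ PadicInt.toZMod x = 0 := by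
  rw [← RingHom.mem_ker, PadicInt.ker_toZMod, IsLocalRing.mem_maximalIdeal, PadicInt.mem_nonunits]

lemma Padic.norm_pow_sub_self_lt_one (hz : ‖z‖ ≤ 1) : ‖z ^ p - z‖ < 1 := by
  obtain ⟨z, rfl⟩ : ∃ y : ℤ_[p], (y : ℚ_[p]) = z := ⟨⟨z, hz⟩, rfl⟩
  have : ‖z ^ p - z‖ < 1 := by
    rw [PadicInt.norm_lt_one_iff_toZMod_eq_zero]
    simp
  exact_mod_cast this

lemma Padic.norm_pow_pow_sub_self_lt_one (hz : ‖z‖ ≤ 1) (N : ℕ) : ‖z ^ p ^ N - z‖ < 1 := by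
  obtain ⟨z, rfl⟩ : ∃ y : ℤ_[p], (y : ℚ_[p]) = z := ⟨⟨z, hz⟩, rfl⟩
  have : ‖z ^ p ^ N - z‖ < 1 := by
    rw [PadicInt.norm_lt_one_iff_toZMod_eq_zero]
    simp
  exact_mod_cast this

lemma mem_polylogDomain_of_norm_sub_lt_one (hz : z ∈ polylogDomain p) {y : ℚ_[p]}
    (hy : ‖y - z‖ < 1) : y ∈ polylogDomain p := by
  constructor
  · rw [← sub_add_cancel y z]
    exact (IsUltrametricDist.norm_add_le_max _ _).trans (max_le hy.le hz.1)
  · have h : 1 - y = -(y - z) + (1 - z) := by ring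
    rw [h, IsUltrametricDist.norm_add_eq_max_of_norm_ne_norm, norm_neg, hz.2, max_eq_right hy.le]
    rw [norm_neg, hz.2]
    exact hy.ne

lemma pow_pow_mem_polylogDomain (hz : z ∈ polylogDomain p) (N : ℕ) :
    z ^ p ^ N ∈ polylogDomain p :=
  mem_polylogDomain_of_norm_sub_lt_one hz (Padic.norm_pow_pow_sub_self_lt_one hz.1 N)

lemma pow_mem_polylogDomain (hz : z ∈ polylogDomain p) : z ^ p ∈ polylogDomain p := by
  simpa using pow_pow_mem_polylogDomain hz 1

/-- The error is exactly $z^N$ times the transform of `shiftMap N f - f`, which is small when `N` is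
highly divisible by `p`. Used in the limit along powers of `p`, and with `N = p` for reduction
modulo `p`. -/
lemma norm_mahlerTransform_sub_sum_le (f : C(ℤ_[p], ℚ_[p])) (hz : z ∈ polylogDomain p) (N : ℕ) :
    ‖(1 - z ^ N) * mahlerTransform f z - ∑ n ∈ Finset.range N, f n * z ^ n‖ ≤
      ‖shiftMap N f - f‖ := by
  have h : (1 - z ^ N) * mahlerTransform f z - ∑ n ∈ Finset.range N, f n * z ^ n =
      z ^ N * mahlerTransform (shiftMap N f - f) z := by
    rw [mahlerTransform_sub _ _ hz]
    linear_combination mahlerTransform_eq_sum_add f hz N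
  rw [h, norm_mul, norm_pow]
  exact (mul_le_of_le_one_left (norm_nonneg _) (pow_le_one₀ (norm_nonneg _) hz.1)).trans
    (norm_mahlerTransform_le _ hz)

lemma tendsto_natCast_pow_zero : Tendsto (fun N : ℕ => ((p ^ N : ℕ) : ℤ_[p])) atTop (𝓝 0) := by
  rw [tendsto_zero_iff_norm_tendsto_zero]
  have h : (fun N : ℕ => ‖((p ^ N : ℕ) : ℤ_[p])‖) = fun N => ((p : ℝ)⁻¹) ^ N := by
    ext N
    simp
  rw [h]
  refine tendsto_pow_atTop_nhds_zero_of_lt_one (by positivity) (inv_lt_one_of_one_lt₀ ?_)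
  exact_mod_cast (Fact.out : p.Prime).one_lt

lemma tendsto_norm_shiftMap_sub (f : C(ℤ_[p], ℚ_[p])) :
    Tendsto (fun N : ℕ => ‖shiftMap ((p ^ N : ℕ) : ℤ_[p]) f - f‖) atTop (𝓝 0) := by
  rw [Metric.tendsto_atTop]
  intro ε hε
  obtain ⟨δ, hδ, h⟩ := f.uniform_continuity (ε / 2) (by positivity)
  obtain ⟨N, hN⟩ := Metric.tendsto_atTop.1 (tendsto_natCast_pow_zero (p := p)) δ hδ
  refine ⟨N, fun n hn => ?_⟩
  rw [dist_zero_right, norm_norm]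
  refine lt_of_le_of_lt ((ContinuousMap.norm_le _ (half_pos hε).le).2 fun x => ?_) (half_lt_self hε)
  have := h (x := x + ((p ^ n : ℕ) : ℤ_[p])) (y := x)
    (by simpa only [dist_eq_norm, add_sub_cancel_left, sub_zero] using hN n hn)
  rw [dist_eq_norm] at this
  exact this.le

/-- The Riemann sums of the distribution; several later identities are checked on them and passed to
the limit. -/
lemma tendsto_mahlerTransform (f : C(ℤ_[p], ℚ_[p])) (hz : z ∈ polylogDomain p) :
    Tendsto (fun N => (1 - z ^ p ^ N)⁻¹ * ∑ n ∈ Finset.range (p ^ N), f n * z ^ n) atTop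
      (𝓝 (mahlerTransform f z)) := by
  rw [tendsto_iff_norm_sub_tendsto_zero]
  refine squeeze_zero (fun N => norm_nonneg _) (fun N => ?_) (tendsto_norm_shiftMap_sub f)
  have h := pow_pow_mem_polylogDomain hz N
  have h0 := one_sub_ne_zero_of_mem h
  refine le_trans (le_of_eq ?_) (norm_mahlerTransform_sub_sum_le f hz (p ^ N))
  have : (1 - z ^ p ^ N) * mahlerTransform f z - ∑ n ∈ Finset.range (p ^ N), f n * z ^ n =
      -((1 - z ^ p ^ N) * ((1 - z ^ p ^ N)⁻¹ * ∑ n ∈ Finset.range (p ^ N), f n * z ^ n -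
        mahlerTransform f z)) := by
    rw [mul_sub, mul_inv_cancel_left₀ h0]
    ring
  rw [this, norm_neg, norm_mul, h.2, one_mul]

lemma mem_polylogDomain_of_norm_lt_one (hz : ‖z‖ < 1) : z ∈ polylogDomain p :=
  mem_polylogDomain_of_norm_sub_lt_one (z := 0) ⟨by simp, by simp⟩ (by simpa using hz)

/-- On the residue disc of `0` the transform is the generating series of the values of `f`. -/
lemma hasSum_mahlerTransform_of_norm_lt_one (f : C(ℤ_[p], ℚ_[p])) (hz : ‖z‖ < 1) :
    HasSum (fun n : ℕ => f n * z ^ n) (mahlerTransform f z) := by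
  have hD := mem_polylogDomain_of_norm_lt_one hz
  have hp := tendsto_pow_atTop_nhds_zero_of_lt_one (norm_nonneg z) hz
  have hs : Summable fun n : ℕ => f n * z ^ n := by
    apply NonarchimedeanAddGroup.summable_of_tendsto_cofinite_zero
    rw [Nat.cofinite_eq_atTop]
    refine squeeze_zero_norm (a := fun n => ‖f‖ * ‖z‖ ^ n) (fun n => ?_)
      (by simpa using hp.const_mul ‖f‖)
    rw [norm_mul, norm_pow]
    gcongr
    exact f.norm_coe_le_norm _
  convert hs.hasSum
  refine (tendsto_nhds_unique hs.hasSum.tendsto_sum_nat ?_).symm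
  rw [tendsto_iff_norm_sub_tendsto_zero]
  refine squeeze_zero (fun N => norm_nonneg _) (fun N => ?_) (by simpa using hp.mul_const ‖f‖)
  rw [mahlerTransform_eq_sum_add f hD N, sub_add_cancel_left, norm_neg, norm_mul, norm_pow]
  gcongr
  refine (norm_mahlerTransform_le _ hD).trans
    ((ContinuousMap.norm_le _ (norm_nonneg _)).2 fun x => ?_)
  exact f.norm_coe_le_norm _

lemma mahlerTransform_apply_zero (f : C(ℤ_[p], ℚ_[p])) : mahlerTransform f 0 = f 0 := by
  have h := mahlerTransform_eq_add_shiftMap_one f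
    (mem_polylogDomain_of_norm_lt_one (p := p) (z := 0) (by simp))
  simpa using h

end MahlerTransform

/-! ### Overconvergence from exponential decay of Mahler coefficients -/

section Overconvergence

variable {p : ℕ} [Fact p.Prime]

lemma IsOverconvergent.congr {h g : ℚ_[p] → ℚ_[p]} (hh : IsOverconvergent p h)
    (hg : EqOn h g (polylogDomain p)) : IsOverconvergent p g := by
  obtain ⟨a, b, ρ, h1, h2, h3, h4⟩ := hh
  exact ⟨a, b, ρ, h1, h2, h3, fun z hz => hg hz ▸ h4 z hz⟩

lemma isOverconvergent_mahlerTransform {f : C(ℤ_[p], ℚ_[p])} {ρ C : ℝ} (hρ : 1 < ρ)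
    (hf : ∀ n, ‖mahlerCoeff f n‖ * ρ ^ n ≤ C) : IsOverconvergent p (mahlerTransform f) := by
  obtain ⟨σ, hσ1, hσρ⟩ := exists_between hρ
  have hσ0 : 0 < σ := one_pos.trans hσ1
  have hρ0 : 0 < ρ := one_pos.trans hρ
  have ht : Tendsto (fun n => ‖mahlerCoeff f n‖ * σ ^ n) atTop (𝓝 0) := by
    refine squeeze_zero (fun n => by positivity) (fun n => ?_)
      (by simpa using (tendsto_pow_atTop_nhds_zero_of_lt_one (div_nonneg hσ0.le hρ0.le)
        ((div_lt_one hρ0).2 hσρ)).const_mul C)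
    calc _ = ‖mahlerCoeff f n‖ * ρ ^ n * (σ / ρ) ^ n := by rw [div_pow]; field_simp
      _ ≤ _ := by gcongr; exact hf n
  have hY (m : ℕ) : ‖(X - Polynomial.C 1 : ℚ_[p][X]).coeff m‖ * σ ^ m ≤ σ := by
    rw [coeff_sub, coeff_X, Polynomial.coeff_C]
    rcases m with _ | _ | m
    · simpa using hσ1.le
    · simp
    · simpa using hσ0.le
  let d := polyCompCoeff (mahlerCoeff f) (X - Polynomial.C 1)
  -- Since $z/(1-z)=1/(1-z)-1$, substituting `X - 1` gives a series in $1/(1-z)$ alone; the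
  -- prefactor $(1-z)^{-1}$ shifts its index by one.
  refine ⟨0, fun n => if n = 0 then 0 else d (n - 1), σ, hσ1, by simp, ?_, fun z hz => ?_⟩
  · rw [← tendsto_add_atTop_iff_nat 1]
    have := (tendsto_polyCompCoeff hσ0 hσ0.le hY ht).mul_const σ
    rw [zero_mul] at this
    refine this.congr fun n => ?_
    simp [d, pow_succ, mul_assoc]
  · have h0 := one_sub_ne_zero_of_mem hz
    have h1 : z * (1 - z)⁻¹ = (1 - z)⁻¹ - 1 := by field_simp; ring
    have h2 := (hasSum_mahlerTransform f hz).mul_left (1 - z)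
    have h3 : HasSum
        (fun n => mahlerCoeff f n * ((X - Polynomial.C 1 : ℚ_[p][X]).eval (1 - z)⁻¹) ^ n)
        ((1 - z) * mahlerTransform f z) := by
      refine h2.congr_fun fun n => ?_
      rw [h1]
      simp only [eval_sub, eval_X, eval_C]
      field_simp
    have h4 := (hasSum_polyCompCoeff hσ0 hσ0.le hY ht
      ((norm_inv_one_sub hz).le.trans hσ1.le) h3).mul_left (1 - z)⁻¹
    rw [inv_mul_cancel_left₀ h0] at h4
    rw [← hasSum_nat_add_iff' 1]
    simp only [Pi.zero_apply, zero_mul, zero_add, Finset.range_one, Finset.sum_singleton, if_true,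
      sub_zero, Nat.add_one_ne_zero, if_false, Nat.add_sub_cancel]
    refine h4.congr_fun fun n => ?_
    rw [pow_succ]
    ring

/-- Pointwise product with the identity function of `ℤ_p`. -/
noncomputable def mulId (f : C(ℤ_[p], ℚ_[p])) : C(ℤ_[p], ℚ_[p]) :=
  ⟨fun x => x * f x, by fun_prop⟩

/-- The discrete Leibniz rule; the second difference of the identity vanishes, so only two terms
remain. -/
lemma fwdDiff_iter_succ_mul_id (f : ℤ_[p] → ℚ_[p]) (n : ℕ) (y : ℤ_[p]) :
    (fwdDiff 1)^[n + 1] (fun x : ℤ_[p] => (x : ℚ_[p]) * f x) y =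
      (y + n + 1) * (fwdDiff 1)^[n + 1] f y + (n + 1) * (fwdDiff 1)^[n] f y := by
  induction n generalizing y with
  | zero =>
    simp [fwdDiff]
    ring
  | succ n ih =>
    rw [Function.iterate_succ_apply', fwdDiff, ih, ih, fwdDiff_iter_apply_add_one f (n + 1),
      fwdDiff_iter_apply_add_one f n]
    push_cast
    ring

lemma mahlerCoeff_mulId (f : C(ℤ_[p], ℚ_[p])) (n : ℕ) :
    mahlerCoeff (mulId f) (n + 1) = (n + 1 : ℕ) * (mahlerCoeff f n + mahlerCoeff f (n + 1)) := by
  refine (fwdDiff_iter_succ_mul_id f n 0).trans ?_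
  simp only [mahlerCoeff]
  push_cast
  ring

/-- If the Mahler coefficients of `x f(x)` decay exponentially, then so do those of `f`. -/
lemma exists_mahlerCoeff_bound_of_mulId {f : C(ℤ_[p], ℚ_[p])}
    (hf : ∃ ρ C : ℝ, 1 < ρ ∧ ∀ n, ‖mahlerCoeff (mulId f) n‖ * ρ ^ n ≤ C) :
    ∃ ρ C : ℝ, 1 < ρ ∧ ∀ n, ‖mahlerCoeff f n‖ * ρ ^ n ≤ C := by
  obtain ⟨ρ, C, hρ, hC⟩ := hf
  obtain ⟨σ, hσ1, hσρ⟩ := exists_between hρ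
  have hσ0 : 0 < σ := one_pos.trans hσ1
  have hρ0 : 0 < ρ := one_pos.trans hρ
  have hC0 : 0 ≤ C := le_trans (by positivity) (hC 0)
  have hlim : Tendsto (fun n : ℕ => (n : ℝ) * (σ / ρ) ^ n) atTop (𝓝 0) :=
    tendsto_self_mul_const_pow_of_lt_one (div_nonneg hσ0.le hρ0.le) ((div_lt_one hρ0).2 hσρ)
  obtain ⟨D, hD⟩ := hlim.bddAbove_range
  -- Dividing `mahlerCoeff_mulId` by `m + 1` costs at most a factor `m + 1`, paid for by lowering
  -- `ρ` to `σ`.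
  have hstep (m : ℕ) : ‖mahlerCoeff f m + mahlerCoeff f (m + 1)‖ * σ ^ m ≤ C * D := by
    have hm : ((m + 1 : ℕ) : ℚ_[p]) ≠ 0 := by exact_mod_cast m.succ_ne_zero
    have h1 : mahlerCoeff f m + mahlerCoeff f (m + 1) =
        ((m + 1 : ℕ) : ℚ_[p])⁻¹ * mahlerCoeff (mulId f) (m + 1) := by
      rw [mahlerCoeff_mulId, inv_mul_cancel_left₀ hm]
    rw [h1, norm_mul]
    calc _ ≤ ((m + 1 : ℕ) : ℝ) * ‖mahlerCoeff (mulId f) (m + 1)‖ * σ ^ (m + 1) := by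
          gcongr
          · exact HasDiscExpansion.norm_inv_natCast_le m.succ_ne_zero
          · exact hσ1.le
          · omega
      _ = (‖mahlerCoeff (mulId f) (m + 1)‖ * ρ ^ (m + 1)) *
          (((m + 1 : ℕ) : ℝ) * (σ / ρ) ^ (m + 1)) := by
        rw [div_pow]; field_simp
      _ ≤ C * D := by
        gcongr
        · exact hC _
        · exact hD ⟨m + 1, rfl⟩
  have hCD : 0 ≤ C * D := le_trans (by positivity) (hstep 0)
  refine ⟨σ, C * D, hσ1, fun n => ?_⟩
  -- Only sums of consecutive coefficients are controlled. Telescoping loses nothing in an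
  -- ultrametric norm, and the end term disappears as `j → ∞` by Mahler's theorem.
  have hiter (j : ℕ) : ‖mahlerCoeff f n‖ ≤ max ‖mahlerCoeff f (n + j)‖ (C * D / σ ^ n) := by
    induction j with
    | zero => exact le_max_left _ _
    | succ j ih =>
      refine ih.trans (max_le ?_ (le_max_right _ _))
      have h2 : mahlerCoeff f (n + j) = (mahlerCoeff f (n + j) + mahlerCoeff f (n + j + 1)) -
          mahlerCoeff f (n + j + 1) := by ring
      rw [h2, ← add_assoc]
      rw [sub_eq_add_neg]
      refine (IsUltrametricDist.norm_add_le_max _ _).trans ?_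
      rw [norm_neg, max_comm]
      refine max_le_max le_rfl ?_
      rw [le_div_iff₀ (by positivity)]
      refine le_trans ?_ (hstep (n + j))
      gcongr
      · exact hσ1.le
      · omega
  rw [← le_div_iff₀ (by positivity)]
  have h3 : Tendsto (fun j => max ‖mahlerCoeff f (n + j)‖ (C * D / σ ^ n)) atTop
      (𝓝 (max 0 (C * D / σ ^ n))) := by
    refine Tendsto.max ?_ tendsto_const_nhds
    simp_rw [add_comm n]
    exact (tendsto_add_atTop_iff_nat n).2
      (tendsto_zero_iff_norm_tendsto_zero.1 (tendsto_mahlerCoeff f))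
  rw [max_eq_right (by positivity)] at h3
  exact ge_of_tendsto' h3 hiter

/-- The Mahler coefficients of a `p`-periodic function decay exponentially. -/
lemma exists_mahlerCoeff_bound_of_periodic (hp2 : 2 < p) {f : C(ℤ_[p], ℚ_[p])}
    (hf : shiftMap p f = f) (hf1 : ‖f‖ ≤ 1) :
    ∃ ρ C : ℝ, 1 < ρ ∧ ∀ n, ‖mahlerCoeff f n‖ * ρ ^ n ≤ C := by
  have hp : p.Prime := Fact.out
  have hp0 : (0 : ℝ) < p := by exact_mod_cast hp.pos
  -- With `ρ ^ (p - 1) = p`, the factor `p` in the middle binomial coefficients pays for lowering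
  -- the index by at most `p - 1`.
  let ρ : ℝ := (p : ℝ) ^ (((p - 1 : ℕ) : ℝ)⁻¹)
  have hρp : ρ ^ (p - 1) = p := Real.rpow_inv_natCast_pow hp0.le (by omega)
  have hρ1 : 1 < ρ := by
    refine Real.one_lt_rpow (by exact_mod_cast hp.one_lt) ?_
    rw [inv_pos]
    exact_mod_cast (by omega : 0 < p - 1)
  have hρ0 : 0 < ρ := one_pos.trans hρ1
  refine ⟨ρ, p, hρ1, fun n => ?_⟩
  induction n using Nat.strong_induction_on with
  | _ n ih =>
    rcases lt_or_ge n p with hn | hn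
    · calc _ ≤ 1 * ρ ^ (p - 1) := by
            gcongr
            · exact (norm_mahlerCoeff_le f n).trans hf1
            · exact hρ1.le
            · omega
        _ = p := by rw [hρp, one_mul]
    · obtain ⟨m, rfl⟩ := Nat.exists_eq_add_of_le' hn
      -- Expanding the shift by `p` in differences, periodicity cancels the term of order `0`, so
      -- the difference of order `p` is a combination of lower ones with coefficients divisible by
      -- `p`.
      have h1 := shift_eq_sum_fwdDiff_iter (1 : ℤ_[p]) ((fwdDiff 1)^[m] f) p 0
      have h2 : (fwdDiff 1)^[m] f (0 + p • (1 : ℤ_[p])) = mahlerCoeff f m := by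
        rw [← fwdDiff_iter_comp_add, nsmul_one]
        conv_rhs => rw [← hf]
        rfl
      have h6 := Finset.sum_range_succ'
        (fun x => p.choose x • (fwdDiff 1)^[x] ((fwdDiff 1)^[m] f) (0 : ℤ_[p])) (p - 1)
      rw [Nat.sub_add_cancel hp.one_le] at h6
      rw [h2, Finset.sum_range_succ, h6] at h1
      simp only [← Function.iterate_add_apply, Nat.choose_zero_right, Nat.choose_self, one_smul,
        zero_add] at h1
      have h3 : mahlerCoeff f (m + p) =
          -∑ k ∈ Finset.range (p - 1), p.choose (k + 1) • mahlerCoeff f (k + 1 + m) := by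
        simp only [mahlerCoeff] at h1 ⊢
        rw [add_comm m p]
        linear_combination -h1
      rw [h3, norm_neg, ← le_div_iff₀ (by positivity)]
      refine IsUltrametricDist.norm_sum_le_of_forall_le_of_nonneg (by positivity) fun k hk => ?_
      have hk' := Finset.mem_range.1 hk
      rw [le_div_iff₀ (by positivity), nsmul_eq_mul, norm_mul]
      have h4 : ‖((p.choose (k + 1) : ℕ) : ℚ_[p])‖ ≤ (p : ℝ)⁻¹ := by
        obtain ⟨c, hc⟩ := hp.dvd_choose_self (k := k + 1) (by omega) (by omega)
        rw [hc, Nat.cast_mul, norm_mul, Padic.norm_p]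
        exact mul_le_of_le_one_right (by positivity) (by exact_mod_cast Padic.norm_int_le_one c)
      have h5 := ih (k + 1 + m) (by omega)
      calc _ = ‖((p.choose (k + 1) : ℕ) : ℚ_[p])‖ *
            (‖mahlerCoeff f (k + 1 + m)‖ * ρ ^ (k + 1 + m)) * ρ ^ (p - 1 - k) := by
            have h7 : ρ ^ (m + p) = ρ ^ (k + 1 + m) * ρ ^ (p - 1 - k) := by
              rw [← pow_add]
              congr 1
              omega
            rw [h7]
            ring
        _ ≤ (p : ℝ)⁻¹ * p * ρ ^ (p - 1) := by
          refine mul_le_mul (mul_le_mul h4 h5 (by positivity) (by positivity)) ?_ (by positivity)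
            (by positivity)
          exact pow_le_pow_right₀ hρ1.le (Nat.sub_le _ _)
        _ = p := by rw [hρp, inv_mul_cancel₀ hp0.ne', one_mul]

end Overconvergence

/-! ### The functions $x^{-k}1_{\mathbb Z_p^\times}$ -/

section UnitPowers

variable {p : ℕ} [Fact p.Prime]

lemma norm_pow_sub_pow_le {x y : ℚ_[p]} (hx : ‖x‖ ≤ 1) (hy : ‖y‖ ≤ 1) (k : ℕ) :
    ‖x ^ k - y ^ k‖ ≤ ‖x - y‖ := by
  rw [← (Commute.all x y).geom_sum₂_mul, norm_mul]
  refine mul_le_of_le_one_left (norm_nonneg _) ?_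
  refine IsUltrametricDist.norm_sum_le_of_forall_le_of_nonneg zero_le_one fun i _ => ?_
  rw [norm_mul, norm_pow, norm_pow]
  exact mul_le_one₀ (pow_le_one₀ (norm_nonneg _) hx) (by positivity)
    (pow_le_one₀ (norm_nonneg _) hy)

open Classical in
/-- The function `x ↦ x⁻ᵏ` on the units of `ℤ_p`, extended by zero. -/
noncomputable def unitInvPowFun (p : ℕ) [Fact p.Prime] (k : ℕ) (x : ℤ_[p]) : ℚ_[p] :=
  if ‖x‖ = 1 then ((x : ℚ_[p]) ^ k)⁻¹ else 0

lemma unitInvPowFun_of_norm_eq_one {k : ℕ} {x : ℤ_[p]} (hx : ‖x‖ = 1) :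
    unitInvPowFun p k x = ((x : ℚ_[p]) ^ k)⁻¹ := if_pos hx

lemma unitInvPowFun_of_norm_ne_one {k : ℕ} {x : ℤ_[p]} (hx : ‖x‖ ≠ 1) :
    unitInvPowFun p k x = 0 := if_neg hx

lemma norm_unitInvPowFun_le (k : ℕ) (x : ℤ_[p]) : ‖unitInvPowFun p k x‖ ≤ 1 := by
  by_cases hx : ‖x‖ = 1
  · simp [unitInvPowFun_of_norm_eq_one hx, hx]
  · simp [unitInvPowFun_of_norm_ne_one hx]

/-- A unit and a nonunit are at distance exactly `1`, so the cutoff to the units does not spoil the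
Lipschitz constant. -/
lemma norm_unitInvPowFun_sub_le (k : ℕ) (x y : ℤ_[p]) :
    ‖unitInvPowFun p k x - unitInvPowFun p k y‖ ≤ ‖x - y‖ := by
  have hmix {x y : ℤ_[p]} (hx : ‖x‖ = 1) (hy : ‖y‖ ≠ 1) :
      ‖unitInvPowFun p k x - unitInvPowFun p k y‖ ≤ ‖x - y‖ := by
    have h1 : ‖x - y‖ = 1 := by
      rw [sub_eq_add_neg, IsUltrametricDist.norm_add_eq_max_of_norm_ne_norm, norm_neg, hx,
        max_eq_left (PadicInt.norm_le_one y)]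
      rw [norm_neg, hx]
      exact hy.symm
    rw [unitInvPowFun_of_norm_ne_one hy, sub_zero, h1]
    exact norm_unitInvPowFun_le k x
  by_cases hx : ‖x‖ = 1 <;> by_cases hy : ‖y‖ = 1
  · have hx' : ‖(x : ℚ_[p])‖ = 1 := hx
    have hy' : ‖(y : ℚ_[p])‖ = 1 := hy
    have hx0 : (x : ℚ_[p]) ≠ 0 := norm_ne_zero_iff.1 (by simp [hx'])
    have hy0 : (y : ℚ_[p]) ≠ 0 := norm_ne_zero_iff.1 (by simp [hy'])
    rw [unitInvPowFun_of_norm_eq_one hx, unitInvPowFun_of_norm_eq_one hy,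
      inv_sub_inv (pow_ne_zero _ hx0) (pow_ne_zero _ hy0), norm_div, norm_mul, norm_pow, norm_pow,
      hx', hy', one_pow, mul_one, div_one, norm_sub_rev]
    exact_mod_cast norm_pow_sub_pow_le hx'.le hy'.le k
  · exact hmix hx hy
  · rw [norm_sub_rev, norm_sub_rev x]
    exact hmix hy hx
  · simp [unitInvPowFun_of_norm_ne_one hx, unitInvPowFun_of_norm_ne_one hy]

/-- `unitInvPowFun` as a continuous function. -/
noncomputable def unitInvPow (p : ℕ) [Fact p.Prime] (k : ℕ) : C(ℤ_[p], ℚ_[p]) where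
  toFun := unitInvPowFun p k
  continuous_toFun := by
    refine (LipschitzWith.of_dist_le_mul (K := 1) fun x y => ?_).continuous
    simpa [dist_eq_norm] using norm_unitInvPowFun_sub_le k x y

lemma unitInvPow_apply (k : ℕ) (x : ℤ_[p]) : unitInvPow p k x = unitInvPowFun p k x := rfl

/-- This drives both inductions on `k`: for the decay of Mahler coefficients, and for the
differential equation, where multiplication by $x$ corresponds to $z\,d/dz$. -/
lemma mulId_unitInvPow (k : ℕ) : mulId (unitInvPow p (k + 1)) = unitInvPow p k := by
  ext x
  change (x : ℚ_[p]) * unitInvPowFun p (k + 1) x = unitInvPowFun p k x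
  by_cases hx : ‖x‖ = 1
  · have hx0 : (x : ℚ_[p]) ≠ 0 := norm_ne_zero_iff.1 (by simp [hx])
    rw [unitInvPowFun_of_norm_eq_one hx, unitInvPowFun_of_norm_eq_one hx, pow_succ]
    field_simp
  · rw [unitInvPowFun_of_norm_ne_one hx, unitInvPowFun_of_norm_ne_one hx, mul_zero]

lemma shiftMap_unitInvPow_zero : shiftMap (p : ℤ_[p]) (unitInvPow p 0) = unitInvPow p 0 := by
  ext x
  have h : ‖x + p‖ = 1 ↔ ‖x‖ = 1 := by
    rw [← PadicInt.isUnit_iff, ← PadicInt.isUnit_iff, ← not_iff_not, ← mem_nonunits_iff,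
      ← mem_nonunits_iff, PadicInt.mem_nonunits, PadicInt.mem_nonunits,
      PadicInt.norm_lt_one_iff_toZMod_eq_zero, PadicInt.norm_lt_one_iff_toZMod_eq_zero]
    simp
  simp [unitInvPow_apply, unitInvPowFun, h]

lemma exists_mahlerCoeff_unitInvPow_bound (hp2 : 2 < p) (k : ℕ) :
    ∃ ρ C : ℝ, 1 < ρ ∧ ∀ n, ‖mahlerCoeff (unitInvPow p k) n‖ * ρ ^ n ≤ C := by
  induction k with
  | zero =>
    exact exists_mahlerCoeff_bound_of_periodic hp2 shiftMap_unitInvPow_zero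
      ((ContinuousMap.norm_le _ zero_le_one).2 (norm_unitInvPowFun_le 0))
  | succ k ih =>
    rw [← mulId_unitInvPow] at ih
    exact exists_mahlerCoeff_bound_of_mulId ih

lemma isOverconvergent_mahlerTransform_unitInvPow (hp2 : 2 < p) (k : ℕ) :
    IsOverconvergent p (mahlerTransform (unitInvPow p k)) := by
  obtain ⟨ρ, C, hρ, h⟩ := exists_mahlerCoeff_unitInvPow_bound hp2 k
  exact isOverconvergent_mahlerTransform hρ h

end UnitPowers

/-! ### Local expansions and derivatives of the transform -/

section MahlerTransformExpansion

variable {p : ℕ} [Fact p.Prime]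

lemma polylogDomain_norm_lt_or_eq {z : ℚ_[p]} (hz : z ∈ polylogDomain p) : ‖z‖ < 1 ∨ ‖z‖ = 1 :=
  hz.1.lt_or_eq

/-- Pointwise product with the function `x ↦ x.choose m` on `ℤ_p`. -/
noncomputable def mulChoose (m : ℕ) (f : C(ℤ_[p], ℚ_[p])) : C(ℤ_[p], ℚ_[p]) :=
  ⟨fun x => (mahler m x : ℤ_[p]) * f x, by
    have := (mahler m : C(ℤ_[p], ℤ_[p])).continuous
    fun_prop⟩

lemma mulChoose_natCast (m n : ℕ) (f : C(ℤ_[p], ℚ_[p])) :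
    mulChoose m f (n : ℤ_[p]) = (n.choose m : ℕ) * f n := by
  change ((mahler m (n : ℤ_[p]) : ℤ_[p]) : ℚ_[p]) * f n = _
  rw [mahler_natCast_eq]
  simp

lemma norm_mulChoose_le (m : ℕ) (f : C(ℤ_[p], ℚ_[p])) : ‖mulChoose m f‖ ≤ ‖f‖ := by
  refine (ContinuousMap.norm_le _ (norm_nonneg _)).2 fun x => ?_
  refine (norm_mul _ _).le.trans ?_
  exact (mul_le_of_le_one_left (norm_nonneg _) (PadicInt.norm_le_one _)).trans
    (f.norm_coe_le_norm x)

lemma mulChoose_one (f : C(ℤ_[p], ℚ_[p])) : mulChoose 1 f = mulId f := by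
  ext x
  change ((mahler 1 x : ℤ_[p]) : ℚ_[p]) * f x = x * f x
  rw [mahler_apply, Ring.choose_one_right]

/-- Points congruent modulo $p$ have $p^N$-th powers congruent modulo $p^{N+1}$. -/
lemma tendsto_pow_pow_sub_pow_pow {x y : ℚ_[p]} (hx : ‖x‖ ≤ 1) (hy : ‖y‖ ≤ 1)
    (hxy : ‖x - y‖ < 1) : Tendsto (fun N : ℕ => x ^ p ^ N - y ^ p ^ N) atTop (𝓝 0) := by
  obtain ⟨x, rfl⟩ : ∃ t : ℤ_[p], (t : ℚ_[p]) = x := ⟨⟨x, hx⟩, rfl⟩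
  obtain ⟨y, rfl⟩ : ∃ t : ℤ_[p], (t : ℚ_[p]) = y := ⟨⟨y, hy⟩, rfl⟩
  have h : (p : ℤ_[p]) ∣ x - y := by
    rw [← PadicInt.norm_lt_one_iff_dvd]
    exact_mod_cast hxy
  have hlim := tendsto_zero_iff_norm_tendsto_zero.1 (tendsto_natCast_pow_zero (p := p))
  refine squeeze_zero_norm (fun N => ?_) hlim
  obtain ⟨c, hc⟩ := (dvd_of_mul_right_dvd (pow_succ (p : ℤ_[p]) N ▸ dvd_sub_pow_of_dvd_sub h N))
  have : ((x : ℚ_[p]) ^ p ^ N - (y : ℚ_[p]) ^ p ^ N) = ((p ^ N : ℕ) : ℤ_[p]) * c := by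
    exact_mod_cast congrArg (Subtype.val) hc
  rw [this, norm_mul]
  exact mul_le_of_le_one_right (norm_nonneg _) (PadicInt.norm_le_one c)

lemma hasSum_choose_mul_pow {K : Type*} [NormedField K] (t : K) (n : ℕ) :
    HasSum (fun m => t ^ m * (n.choose m : ℕ)) ((1 + t) ^ n) := by
  rw [add_comm, add_pow]
  simp only [one_pow, mul_one]
  refine hasSum_sum_of_ne_finset_zero fun m hm => ?_
  rw [Nat.choose_eq_zero_of_lt (by simpa using hm)]
  simp

/-- Write $a+h=a(1+t)$ and expand $(1+t)^n$ binomially in the Riemann sums; the coefficient of $t^m$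
tends to the transform of $\binom xm f$ at $a$, and dominated convergence allows the limit termwise.
-/
lemma hasDiscExpansion_mahlerTransform_of_norm_eq_one (f : C(ℤ_[p], ℚ_[p])) {a : ℚ_[p]}
    (ha : a ∈ polylogDomain p) (ha1 : ‖a‖ = 1) :
    HasDiscExpansion (mahlerTransform f) a
      (fun m => (a⁻¹) ^ m * mahlerTransform (mulChoose m f) a) := by
  have ha0 : a ≠ 0 := norm_ne_zero_iff.1 (by simp [ha1])
  refine HasDiscExpansion.of_bounded (C := ‖f‖) (fun n => ?_) fun h hh => ?_
  · rw [norm_mul, norm_pow, norm_inv, ha1, inv_one, one_pow, one_mul]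
    exact (norm_mahlerTransform_le _ ha).trans (norm_mulChoose_le n f)
  have hz : a + h ∈ polylogDomain p := mem_polylogDomain_of_norm_sub_lt_one ha (by simpa using hh)
  set z := a + h with hzdef
  set t := a⁻¹ * h with ht
  have ht1 : ‖t‖ < 1 := by simpa [ht, ha1] using hh
  have hzt : z = a * (1 + t) := by rw [hzdef, ht]; field_simp
  have hbound : Summable fun m => ‖f‖ * ‖t‖ ^ m :=
    (summable_geometric_of_lt_one (norm_nonneg _) ht1).mul_left _
  have hle (m : ℕ) : ‖t ^ m * mahlerTransform (mulChoose m f) a‖ ≤ ‖f‖ * ‖t‖ ^ m := by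
    rw [norm_mul, norm_pow, mul_comm]
    gcongr
    exact (norm_mahlerTransform_le _ ha).trans (norm_mulChoose_le m f)
  have hsum : HasSum (fun m => t ^ m * mahlerTransform (mulChoose m f) a)
      (∑' m, t ^ m * mahlerTransform (mulChoose m f) a) :=
    (Summable.of_norm_bounded hbound hle).hasSum
  have hterms : (fun m => a⁻¹ ^ m * mahlerTransform (mulChoose m f) a * h ^ m) =
      fun m => t ^ m * mahlerTransform (mulChoose m f) a := by
    ext m
    rw [ht, mul_pow]
    ring
  rw [hterms]
  convert hsum
  let S : ℕ → ℚ_[p] := fun N => ∑ n ∈ Finset.range (p ^ N), f n * z ^ n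
  let g : ℕ → ℕ → ℚ_[p] := fun N m => t ^ m * ((1 - a ^ p ^ N)⁻¹ *
    ∑ n ∈ Finset.range (p ^ N), mulChoose m f n * a ^ n)
  have hg : Tendsto (fun N => ∑' m, g N m) atTop
      (𝓝 (∑' m, t ^ m * mahlerTransform (mulChoose m f) a)) := by
    refine tendsto_tsum_of_dominated_convergence hbound
      (fun m => (tendsto_mahlerTransform (mulChoose m f) ha).const_mul _)
      (Eventually.of_forall fun N m => ?_)
    rw [norm_mul, norm_pow, mul_comm, norm_mul,
      norm_inv_one_sub (pow_pow_mem_polylogDomain ha N), one_mul]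
    gcongr
    refine IsUltrametricDist.norm_sum_le_of_forall_le_of_nonneg (norm_nonneg _) fun n _ => ?_
    rw [norm_mul, norm_pow, ha1, one_pow, mul_one]
    exact ((mulChoose m f).norm_coe_le_norm _).trans (norm_mulChoose_le m f)
  have hgS (N : ℕ) : ∑' m, g N m = (1 - a ^ p ^ N)⁻¹ * S N := by
    refine HasSum.tsum_eq ?_
    have := (hasSum_sum (s := Finset.range (p ^ N)) fun n _ =>
      (hasSum_choose_mul_pow t n).mul_left (f n * a ^ n)).mul_left (1 - a ^ p ^ N)⁻¹
    have hS : ∑ n ∈ Finset.range (p ^ N), f n * a ^ n * (1 + t) ^ n = S N := by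
      refine Finset.sum_congr rfl fun n _ => ?_
      rw [hzt, mul_pow]
      ring
    rw [hS] at this
    refine this.congr_fun fun m => ?_
    simp only [g, Finset.mul_sum]
    refine Finset.sum_congr rfl fun n _ => ?_
    rw [mulChoose_natCast]
    ring
  simp only [hgS] at hg
  refine tendsto_nhds_unique (tendsto_mahlerTransform f hz) ?_
  -- The binomial expansion kept the denominator belonging to `a`; replacing it by that of `z` is
  -- harmless in the limit.
  have hdiff : Tendsto (fun N => (1 - z ^ p ^ N)⁻¹ * S N - (1 - a ^ p ^ N)⁻¹ * S N) atTop
      (𝓝 0) := by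
    have h1 := tendsto_zero_iff_norm_tendsto_zero.1 (tendsto_pow_pow_sub_pow_pow hz.1 ha.1
      (by simpa [hzdef] using hh))
    refine squeeze_zero_norm (fun N => ?_) (by simpa using h1.mul_const ‖f‖)
    have hzN := pow_pow_mem_polylogDomain hz N
    have haN := pow_pow_mem_polylogDomain ha N
    rw [← sub_mul, inv_sub_inv (one_sub_ne_zero_of_mem hzN) (one_sub_ne_zero_of_mem haN), norm_mul,
      norm_div, norm_mul, hzN.2, haN.2, mul_one, div_one, sub_sub_sub_cancel_left]
    gcongr
    refine IsUltrametricDist.norm_sum_le_of_forall_le_of_nonneg (norm_nonneg _) fun n _ => ?_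
    rw [norm_mul, norm_pow]
    exact (mul_le_of_le_one_right (norm_nonneg _) (pow_le_one₀ (norm_nonneg _) hz.1)).trans
      (f.norm_coe_le_norm _)
  simpa using hdiff.add hg

lemma hasDiscExpansion_mahlerTransform_zero (f : C(ℤ_[p], ℚ_[p])) :
    HasDiscExpansion (mahlerTransform f) 0 (fun n => f n) :=
  HasDiscExpansion.of_bounded (fun n => f.norm_coe_le_norm _) fun h hh => by
    simpa using hasSum_mahlerTransform_of_norm_lt_one f hh

lemma exists_hasDiscExpansion_mahlerTransform (f : C(ℤ_[p], ℚ_[p])) {a : ℚ_[p]}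
    (ha : a ∈ polylogDomain p) : ∃ c, HasDiscExpansion (mahlerTransform f) a c := by
  rcases polylogDomain_norm_lt_or_eq ha with h | h
  · exact ⟨_, (hasDiscExpansion_mahlerTransform_zero f).recenter (by simpa using h)⟩
  · exact ⟨_, hasDiscExpansion_mahlerTransform_of_norm_eq_one f ha h⟩

/-- Termwise differentiation on the disc of `0`; elsewhere the linear coefficient of the expansion
centred at `z` itself. -/
lemma hasDerivAt_mahlerTransform (f : C(ℤ_[p], ℚ_[p])) {z : ℚ_[p]}
    (hz : z ∈ polylogDomain p) (hz0 : z ≠ 0) :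
    HasDerivAt (mahlerTransform f) (mahlerTransform (mulId f) z / z) z := by
  rcases polylogDomain_norm_lt_or_eq hz with h | h
  · obtain ⟨s, h1, h2⟩ := (hasDiscExpansion_mahlerTransform_zero f).hasDerivAt h
    rw [zero_add] at h1
    suffices mahlerTransform (mulId f) z / z = s from this ▸ h1
    rw [div_eq_iff hz0]
    refine (hasSum_mahlerTransform_of_norm_lt_one (mulId f) h).unique ?_
    rw [← hasSum_nat_add_iff' 1]
    refine HasSum.congr_fun (f := fun n : ℕ => ((n + 1 : ℕ) * f ((n + 1 : ℕ) : ℤ_[p])) * z ^ n * z)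
      ?_ fun n => ?_
    · simpa [mulId] using h2.mul_right z
    · simp [mulId, pow_succ]
      ring
  · obtain ⟨s, h1, h2⟩ := (hasDiscExpansion_mahlerTransform_of_norm_eq_one f hz h).hasDerivAt
      (h := 0) (by simp)
    rw [add_zero] at h1
    suffices mahlerTransform (mulId f) z / z = s from this ▸ h1
    refine HasSum.unique ?_ h2
    convert hasSum_single 0 fun n hn => ?_
    · simp [mulChoose_one, div_eq_inv_mul]
    · simp [hn]

end MahlerTransformExpansion

/-! ### Frobenius as push-forward along multiplication by $p$ -/

section FrobeniusPushforward

variable {p : ℕ} [Fact p.Prime]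

open Classical in
/-- Division by `p` on `pℤ_p`, extended by zero to `ℤ_p`. -/
noncomputable def divPrime (x : ℤ_[p]) : ℤ_[p] :=
  if h : (p : ℤ_[p]) ∣ x then h.choose else 0

lemma divPrime_prime_mul (x : ℤ_[p]) : divPrime ((p : ℤ_[p]) * x) = x := by
  have h : (p : ℤ_[p]) ∣ (p : ℤ_[p]) * x := dvd_mul_right _ _
  rw [divPrime, dif_pos h]
  have hp : (p : ℤ_[p]) ≠ 0 := by exact_mod_cast (Fact.out : p.Prime).ne_zero
  exact (mul_left_cancel₀ hp h.choose_spec).symm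

lemma norm_divPrime_sub_le (x y : ℤ_[p]) : ‖divPrime x - divPrime y‖ ≤ p * ‖x - y‖ := by
  have hp0 : (0 : ℝ) < p := by exact_mod_cast (Fact.out : p.Prime).pos
  have hp1 : (1 : ℝ) ≤ p := by exact_mod_cast (Fact.out : p.Prime).one_le
  by_cases hxy : (p : ℤ_[p]) ∣ x - y
  · by_cases hx : (p : ℤ_[p]) ∣ x
    · obtain ⟨x, rfl⟩ := hx
      obtain ⟨y, rfl⟩ := (dvd_sub_right (dvd_mul_right _ _)).1 hxy
      rw [divPrime_prime_mul, divPrime_prime_mul, ← mul_sub, norm_mul, PadicInt.norm_p,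
        mul_inv_cancel_left₀ hp0.ne']
    · have hy : ¬ (p : ℤ_[p]) ∣ y := fun hy => hx ((dvd_sub_left hy).1 hxy)
      rw [divPrime, divPrime, dif_neg hx, dif_neg hy, sub_zero, norm_zero]
      positivity
  · have h1 : ‖x - y‖ = 1 := by
      refine le_antisymm (PadicInt.norm_le_one _) ?_
      by_contra! h
      exact hxy ((PadicInt.norm_lt_one_iff_dvd (x - y)).1 h)
    rw [h1, mul_one]
    exact (PadicInt.norm_le_one _).trans hp1

lemma continuous_divPrime : Continuous (divPrime : ℤ_[p] → ℤ_[p]) := by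
  refine (LipschitzWith.of_dist_le_mul (K := (p : NNReal)) fun x y => ?_).continuous
  simpa [dist_eq_norm] using norm_divPrime_sub_le x y

/-- The function `x ↦ f (x / p)` on `pℤ_p`, extended by zero. -/
noncomputable def frobeniusPush (f : C(ℤ_[p], ℚ_[p])) : C(ℤ_[p], ℚ_[p]) :=
  ⟨fun x => (1 - unitInvPow p 0 x) * f (divPrime x), by
    have := continuous_divPrime (p := p)
    fun_prop⟩

lemma frobeniusPush_prime_mul (f : C(ℤ_[p], ℚ_[p])) (x : ℤ_[p]) :
    frobeniusPush f (p * x) = f x := by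
  change (1 - unitInvPowFun p 0 (p * x)) * f (divPrime (p * x)) = f x
  have h : ‖(p : ℤ_[p]) * x‖ ≠ 1 :=
    ((PadicInt.norm_lt_one_iff_dvd _).2 (dvd_mul_right _ _)).ne
  rw [unitInvPowFun_of_norm_ne_one h, divPrime_prime_mul, sub_zero, one_mul]

lemma frobeniusPush_natCast_of_not_dvd (f : C(ℤ_[p], ℚ_[p])) {n : ℕ} (hn : ¬ p ∣ n) :
    frobeniusPush f n = 0 := by
  change (1 - unitInvPowFun p 0 n) * f (divPrime n) = 0
  have h : ‖(n : ℤ_[p])‖ = 1 := by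
    refine le_antisymm (PadicInt.norm_le_one _) ?_
    by_contra! h
    have := (PadicInt.norm_int_lt_one_iff_dvd (p := p) n).1 (by simpa using h)
    exact hn (by exact_mod_cast this)
  rw [unitInvPowFun_of_norm_eq_one h]
  simp

lemma sum_range_prime_mul {M : Type*} [AddCommMonoid M] {q : ℕ} (hq : 0 < q) (N : ℕ) (g : ℕ → M)
    (hg : ∀ n, ¬ q ∣ n → g n = 0) :
    ∑ n ∈ Finset.range (q * N), g n = ∑ m ∈ Finset.range N, g (q * m) := by
  have hinj : Function.Injective fun m => q * m := fun a b h => Nat.eq_of_mul_eq_mul_left hq h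
  rw [← Finset.sum_image (f := g) hinj.injOn]
  refine (Finset.sum_subset (fun n hn => ?_) fun n hn hn' => hg n ?_).symm
  · obtain ⟨m, hm, rfl⟩ := Finset.mem_image.1 hn
    exact Finset.mem_range.2 (Nat.mul_lt_mul_of_pos_left (Finset.mem_range.1 hm) hq)
  · rintro ⟨m, rfl⟩
    exact hn' (Finset.mem_image.2 ⟨m, Finset.mem_range.2
      (Nat.lt_of_mul_lt_mul_left (Finset.mem_range.1 hn)), rfl⟩)

/-- In the Riemann sum of level `N + 1` only multiples of `p` survive, which leaves the sum of level
`N` at `z ^ p`, with the same denominator. -/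
lemma mahlerTransform_frobeniusPush (f : C(ℤ_[p], ℚ_[p])) {z : ℚ_[p]}
    (hz : z ∈ polylogDomain p) :
    mahlerTransform (frobeniusPush f) z = mahlerTransform f (z ^ p) := by
  have h1 := (tendsto_add_atTop_iff_nat 1).2 (tendsto_mahlerTransform (frobeniusPush f) hz)
  refine tendsto_nhds_unique h1 ((tendsto_mahlerTransform f (pow_mem_polylogDomain hz)).congr
    fun N => ?_)
  rw [← pow_mul, ← pow_succ', pow_succ' p N, sum_range_prime_mul (Fact.out : p.Prime).pos]
  · congr 1
    refine Finset.sum_congr rfl fun n _ => ?_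
    rw [Nat.cast_mul, frobeniusPush_prime_mul, pow_mul]
  · intro n hn
    rw [frobeniusPush_natCast_of_not_dvd f hn, zero_mul]

lemma mahlerTransform_one {z : ℚ_[p]} (hz : z ∈ polylogDomain p) :
    mahlerTransform (1 : C(ℤ_[p], ℚ_[p])) z = (1 - z)⁻¹ := by
  have h := mahlerTransform_eq_add_shiftMap_one 1 hz
  have h1 : shiftMap 1 (1 : C(ℤ_[p], ℚ_[p])) = 1 := by ext; simp
  rw [h1, ContinuousMap.one_apply] at h
  refine eq_inv_of_mul_eq_one_left ?_
  linear_combination h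

/-- The Frobenius relation in weight `0`: the indicator of the units is `1` minus its push-forward.
-/
lemma mahlerTransform_unitInvPow_zero {z : ℚ_[p]} (hz : z ∈ polylogDomain p) :
    mahlerTransform (unitInvPow p 0) z = z / (1 - z) - z ^ p / (1 - z ^ p) := by
  have h : unitInvPow p 0 = 1 - frobeniusPush 1 := by
    ext x
    simp [frobeniusPush]
  have h1 := one_sub_ne_zero_of_mem hz
  have h2 := one_sub_ne_zero_of_mem (pow_mem_polylogDomain hz)
  rw [h, mahlerTransform_sub _ _ hz, mahlerTransform_frobeniusPush _ hz, mahlerTransform_one hz,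
    mahlerTransform_one (pow_mem_polylogDomain hz)]
  field_simp
  ring

end FrobeniusPushforward

/-! ### Tate functions: a Frobenius-stable weakening of overconvergence -/

section TateFunctions

variable {p : ℕ} [Fact p.Prime]

/-- `h` is on `polylogDomain p` the sum of a power series in `z` and a power series in
`1 / (1 - z)`, both with coefficients tending to `0`; the latter is written as the transform of a
continuous function. -/
def IsTateFunction (h : ℚ_[p] → ℚ_[p]) : Prop :=
  ∃ (a : ℕ → ℚ_[p]) (f : C(ℤ_[p], ℚ_[p])), Tendsto a atTop (𝓝 0) ∧
    ∀ z ∈ polylogDomain p, HasSum (fun n => a n * z ^ n) (h z - mahlerTransform f z)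

namespace IsTateFunction

variable {h g : ℚ_[p] → ℚ_[p]}

lemma congr (hh : IsTateFunction h) (hg : EqOn h g (polylogDomain p)) : IsTateFunction g := by
  obtain ⟨a, f, h1, h2⟩ := hh
  exact ⟨a, f, h1, fun z hz => hg hz ▸ h2 z hz⟩

lemma add (hh : IsTateFunction h) (hg : IsTateFunction g) : IsTateFunction fun z => h z + g z := by
  obtain ⟨a, f, h1, h2⟩ := hh
  obtain ⟨b, f', h3, h4⟩ := hg
  refine ⟨a + b, f + f', by rw [← add_zero (0 : ℚ_[p])]; exact h1.add h3, fun z hz => ?_⟩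
  rw [mahlerTransform_add _ _ hz, add_sub_add_comm]
  simpa [add_mul] using (h2 z hz).add (h4 z hz)

lemma const_mul (c : ℚ_[p]) (hh : IsTateFunction h) : IsTateFunction fun z => c * h z := by
  obtain ⟨a, f, h1, h2⟩ := hh
  refine ⟨fun n => c * a n, c • f, by simpa using h1.const_mul c, fun z hz => ?_⟩
  rw [mahlerTransform_smul _ _ hz, ← mul_sub]
  simpa [mul_assoc] using (h2 z hz).mul_left c

lemma zero : IsTateFunction fun _ : ℚ_[p] => (0 : ℚ_[p]) := by
  refine ⟨0, 0, tendsto_const_nhds, fun z hz => ?_⟩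
  have : mahlerTransform (0 : C(ℤ_[p], ℚ_[p])) z = 0 := by
    simpa using mahlerTransform_smul 0 0 hz
  simp [this, hasSum_zero]

lemma sum {ι : Type*} (s : Finset ι) {h : ι → ℚ_[p] → ℚ_[p]} (hh : ∀ i ∈ s, IsTateFunction (h i)) :
    IsTateFunction fun z => ∑ i ∈ s, h i z := by
  classical
  induction s using Finset.induction_on with
  | empty => simpa using zero
  | insert i s hi ih =>
    simp only [Finset.sum_insert hi]
    exact (hh i (Finset.mem_insert_self _ _)).add
      (ih fun j hj => hh j (Finset.mem_insert_of_mem hj))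

/-- This is what writing the polar part as a transform is for: `frobeniusPush` replaces any
re-expansion of $1/(1-z^p)$. -/
lemma comp_frobenius (hh : IsTateFunction h) : IsTateFunction fun z => h (z ^ p) := by
  obtain ⟨a, f, h1, h2⟩ := hh
  have hp : 0 < p := (Fact.out : p.Prime).pos
  refine ⟨fun n => if p ∣ n then a (n / p) else 0, frobeniusPush f, ?_, fun z hz => ?_⟩
  · rw [Metric.tendsto_atTop] at h1 ⊢
    intro ε hε
    obtain ⟨N, hN⟩ := h1 ε hε
    refine ⟨p * N, fun n hn => ?_⟩
    split_ifs
    · exact hN _ ((Nat.le_div_iff_mul_le hp).2 (by rwa [mul_comm]))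
    · simpa using hε
  · rw [mahlerTransform_frobeniusPush _ hz]
    have hinj : Function.Injective fun m => p * m := fun a b h => Nat.eq_of_mul_eq_mul_left hp h
    rw [← hinj.hasSum_iff]
    · refine (h2 _ (pow_mem_polylogDomain hz)).congr_fun fun n => ?_
      simp [Nat.mul_div_cancel_left _ hp, pow_mul]
    · intro n hn
      have : ¬ p ∣ n := fun ⟨m, hm⟩ => hn ⟨m, hm.symm⟩
      simp [this]

lemma frobeniusPoly (hh : IsTateFunction h) (P : ℚ_[p][X]) :
    IsTateFunction (frobeniusPoly p P h) := by
  have hiter (i : ℕ) : IsTateFunction fun z => h (z ^ p ^ i) := by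
    induction i with
    | zero => simpa using hh
    | succ i ih =>
      have := ih.comp_frobenius
      simpa [← pow_mul, ← pow_succ'] using this
  exact sum _ fun i _ => (hiter i).const_mul _

/-- A Tate function that is constant on the residue disc of `0` is constant. -/
lemma eq_apply_zero (hh : IsTateFunction h) (hc : ∀ z, ‖z‖ < 1 → h z = h 0) {z : ℚ_[p]}
    (hz : z ∈ polylogDomain p) : h z = h 0 := by
  obtain ⟨a, f, h1, h2⟩ := hh
  have h0 : (0 : ℚ_[p]) ∈ polylogDomain p := mem_polylogDomain_of_norm_lt_one (by simp)
  obtain ⟨C, hC⟩ := (tendsto_zero_iff_norm_tendsto_zero.1 h1).bddAbove_range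
  have hexp : HasDiscExpansion h 0 (fun n => a n + f n) := by
    have ha : HasDiscExpansion (fun z => h z - mahlerTransform f z) 0 a :=
      HasDiscExpansion.of_bounded (C := C) (fun n => hC ⟨n, rfl⟩) fun x hx => by
        simpa using h2 x (mem_polylogDomain_of_norm_lt_one hx)
    exact (ha.add (hasDiscExpansion_mahlerTransform_zero f)).congr fun x _ => by ring
  have hexp' : HasDiscExpansion h 0 (fun n => if n = 0 then h 0 else 0) :=
    (HasDiscExpansion.const (h 0) 0).congr fun x hx => by rw [zero_add, hc x hx]
  have hcoeff (n : ℕ) (hn : n ≠ 0) : a n + f n = 0 := by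
    have := hexp.coeff_unique hexp'
    simpa [hn] using congrFun this n
  -- By continuity $f(n)=\lim f(n+p^N)=-\lim a_{n+p^N}=0$; this covers `n = 0`, as $n+p^N$ is never
  -- zero.
  have hfn (n : ℕ) : f n = 0 := by
    have hpN : Tendsto (fun N : ℕ => n + p ^ N) atTop atTop :=
      tendsto_atTop_mono (fun N => Nat.le_add_left _ _)
        (tendsto_pow_atTop_atTop_of_one_lt (Fact.out : p.Prime).one_lt)
    have h3 : Tendsto (fun N : ℕ => f ((n : ℤ_[p]) + ((p ^ N : ℕ) : ℤ_[p]))) atTop (𝓝 (f n)) := by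
      have := (tendsto_natCast_pow_zero (p := p)).const_add (n : ℤ_[p])
      rw [add_zero] at this
      exact (f.continuous.tendsto _).comp this
    refine tendsto_nhds_unique h3 ?_
    have h4 := (h1.comp hpN).neg
    rw [neg_zero] at h4
    refine h4.congr fun N => ?_
    have h5 := hcoeff (n + p ^ N) (by have := pow_pos (Fact.out : p.Prime).pos N; omega)
    rw [Function.comp_apply, ← Nat.cast_add]
    linear_combination -h5
  have hf : f = 0 := by
    refine ContinuousMap.coe_injective (PadicInt.denseRange_natCast.equalizer
      (map_continuous f) (map_continuous _) (funext fun n => ?_))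
    simpa using hfn n
  have ha0 (n : ℕ) (hn : n ≠ 0) : a n = 0 := by simpa [hf] using hcoeff n hn
  have key (y : ℚ_[p]) (hy : y ∈ polylogDomain p) : h y = a 0 := by
    have h3 := h2 y hy
    have h4 : mahlerTransform f y = 0 := by
      simpa [hf] using mahlerTransform_smul 0 0 hy
    rw [h4, sub_zero] at h3
    refine h3.unique ?_
    convert hasSum_single 0 fun _ hn => ?_
    · simp
    · simp [ha0 _ hn]
  rw [key z hz, key 0 h0]

end IsTateFunction

lemma tendsto_zero_of_tendsto_norm_mul_pow {c : ℕ → ℚ_[p]} {ρ : ℝ} (hρ : 1 ≤ ρ)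
    (hc : Tendsto (fun n => ‖c n‖ * ρ ^ n) atTop (𝓝 0)) : Tendsto c atTop (𝓝 0) :=
  squeeze_zero_norm (fun _ => le_mul_of_one_le_right (norm_nonneg _) (one_le_pow₀ hρ)) hc

lemma IsOverconvergent.isTateFunction {h : ℚ_[p] → ℚ_[p]} (hh : IsOverconvergent p h) :
    IsTateFunction h := by
  obtain ⟨a, b, ρ, hρ, ha, hb, hs⟩ := hh
  have ha0 := tendsto_zero_of_tendsto_norm_mul_pow hρ.le ha
  have hb0 := tendsto_zero_of_tendsto_norm_mul_pow hρ.le hb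
  have hY (m : ℕ) : ‖(X + Polynomial.C 1 : ℚ_[p][X]).coeff m‖ * 1 ^ m ≤ 1 := by
    rw [coeff_add, coeff_X, Polynomial.coeff_C]
    rcases m with _ | _ | m <;> simp
  have hb1 : Tendsto (fun n => ‖b (n + 1)‖ * 1 ^ n) atTop (𝓝 0) := by
    simpa using (tendsto_add_atTop_iff_nat 1).2 (tendsto_zero_iff_norm_tendsto_zero.1 hb0)
  let d := polyCompCoeff (fun n => b (n + 1)) (X + Polynomial.C 1)
  have hd : Tendsto d atTop (𝓝 0) :=
    tendsto_zero_of_tendsto_norm_mul_pow le_rfl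
      (tendsto_polyCompCoeff one_pos zero_le_one hY hb1)
  -- Inverse of the earlier substitution: $1/(1-z)=1+z/(1-z)$. One factor $(1-z)^{-1}$ is split off,
  -- so `b 0` has to join the power series in `z`.
  let f : C(ℤ_[p], ℚ_[p]) := PadicInt.mahlerSeries d
  have hf (n : ℕ) : mahlerCoeff f n = d n := PadicInt.fwdDiff_mahlerSeries hd n
  refine ⟨fun n => a n + if n = 0 then b 0 else 0, f, ?_, fun z hz => ?_⟩
  · have h1 : Tendsto (fun n => if n = 0 then b 0 else 0) atTop (𝓝 0) := by
      refine tendsto_const_nhds.congr' ?_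
      filter_upwards [eventually_ne_atTop 0] with n hn
      simp [hn]
    simpa using ha0.add h1
  · have h0 := one_sub_ne_zero_of_mem hz
    have hsa : Summable fun n => a n * z ^ n := by
      apply NonarchimedeanAddGroup.summable_of_tendsto_cofinite_zero
      rw [Nat.cofinite_eq_atTop]
      refine squeeze_zero_norm (fun n => ?_) (tendsto_zero_iff_norm_tendsto_zero.1 ha0)
      rw [norm_mul, norm_pow]
      exact mul_le_of_le_one_right (norm_nonneg _) (pow_le_one₀ (norm_nonneg _) hz.1)
    have hsb : HasSum (fun n => b n * ((1 - z)⁻¹) ^ n) (h z - ∑' n, a n * z ^ n) := by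
      refine ((hs z hz).sub hsa.hasSum).congr_fun fun n => ?_
      ring
    have h1 : HasSum (fun n => b (n + 1) * ((X + Polynomial.C 1 : ℚ_[p][X]).eval
        (z * (1 - z)⁻¹)) ^ n) ((1 - z) * (h z - ∑' n, a n * z ^ n - b 0)) := by
      have h2 := (((hasSum_nat_add_iff' 1).2 hsb).mul_left (1 - z))
      simp only [Finset.range_one, Finset.sum_singleton, pow_zero, mul_one] at h2
      refine h2.congr_fun fun n => ?_
      have h3 : (X + Polynomial.C 1 : ℚ_[p][X]).eval (z * (1 - z)⁻¹) = (1 - z)⁻¹ := by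
        simp only [eval_add, eval_X, eval_C]
        field_simp
        ring
      rw [h3, pow_succ]
      field_simp
    have h2 := hasSum_polyCompCoeff one_pos zero_le_one hY hb1 (norm_mul_inv_one_sub_le hz) h1
    have h3 : mahlerTransform f z = h z - ∑' n, a n * z ^ n - b 0 := by
      refine (hasSum_mahlerTransform f hz).unique ?_
      have h4 := h2.mul_left (1 - z)⁻¹
      rw [inv_mul_cancel_left₀ h0] at h4
      refine h4.congr_fun fun n => ?_
      rw [hf]
      ring
    rw [h3]
    have h5 := hsa.hasSum.add (hasSum_ite_eq 0 (b 0))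
    have h6 : h z - (h z - ∑' n, a n * z ^ n - b 0) = ∑' n, a n * z ^ n + b 0 := by ring
    rw [h6]
    refine h5.congr_fun fun n => ?_
    rcases eq_or_ne n 0 with rfl | hn <;> simp [*]

end TateFunctions

/-! ### Uniqueness of Coleman primitives -/

section Uniqueness

variable {p : ℕ} [Fact p.Prime]

lemma frobeniusPoly_eq_sum (P : ℚ_[p][X]) (F : ℚ_[p] → ℚ_[p]) (z : ℚ_[p]) :
    frobeniusPoly p P F z = ∑ i ∈ P.support, P.coeff i * F (z ^ p ^ i) := rfl

lemma frobeniusPoly_comm (P Q : ℚ_[p][X]) (F : ℚ_[p] → ℚ_[p]) (z : ℚ_[p]) :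
    frobeniusPoly p P (frobeniusPoly p Q F) z = frobeniusPoly p Q (frobeniusPoly p P F) z := by
  simp only [frobeniusPoly_eq_sum, Finset.mul_sum]
  rw [Finset.sum_comm]
  refine Finset.sum_congr rfl fun i _ => Finset.sum_congr rfl fun j _ => ?_
  rw [← pow_mul, ← pow_mul, mul_comm (p ^ i)]
  ring

lemma frobeniusPoly_sub (P : ℚ_[p][X]) (F G : ℚ_[p] → ℚ_[p]) (z : ℚ_[p]) :
    frobeniusPoly p P (fun z => F z - G z) z = frobeniusPoly p P F z - frobeniusPoly p P G z := by
  simp only [frobeniusPoly_eq_sum, mul_sub, Finset.sum_sub_distrib]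

lemma frobeniusPoly_of_invariant (P : ℚ_[p][X]) {F : ℚ_[p] → ℚ_[p]} {z : ℚ_[p]}
    (hF : ∀ i, F (z ^ p ^ i) = F z) : frobeniusPoly p P F z = P.eval 1 * F z := by
  rw [frobeniusPoly_eq_sum, eval_eq_sum, Polynomial.sum, Finset.sum_mul]
  simp [hF]

lemma eval_one_ne_zero_of_forall_root_of_unity {P : ℚ_[p][X]}
    (hP : ∀ n : ℕ, 0 < n → ∀ ζ : PadicAlgCl p, ζ ^ n = 1 → aeval ζ P ≠ 0) : P.eval 1 ≠ 0 := by
  intro h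
  refine hP 1 one_pos 1 (one_pow 1) ?_
  rw [← map_one (algebraMap ℚ_[p] (PadicAlgCl p)), aeval_algebraMap_apply, coe_aeval_eq_eval, h,
    map_zero]

/-- The difference $H$ has zero derivative, so it is constant on residue discs, which $z\mapsto z^p$
preserves. Hence $P(\varphi^*)Q(\varphi^*)H=P(1)Q(1)H$ is a Tate function, constant by
`IsTateFunction.eq_apply_zero`, and $P(1)Q(1)\ne0$. -/
lemma IsColemanFunction.eqOn {F G D : ℚ_[p] → ℚ_[p]} (hF : IsColemanFunction p F)
    (hG : IsColemanFunction p G) (h0 : F 0 = G 0)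
    (hF' : ∀ z ∈ polylogDomain p, z ≠ 0 → HasDerivAt F (D z) z)
    (hG' : ∀ z ∈ polylogDomain p, z ≠ 0 → HasDerivAt G (D z) z) :
    EqOn F G (polylogDomain p) := by
  let H : ℚ_[p] → ℚ_[p] := fun z => F z - G z
  have hconst : ∀ a ∈ polylogDomain p, ∀ h, ‖h‖ < 1 → H (a + h) = H a := by
    intro a ha h hh
    obtain ⟨q, hq⟩ := hF.analytic a ha
    obtain ⟨q', hq'⟩ := hG.analytic a ha
    have hexp := ((HasDiscExpansion.of_hasFPowerSeriesOnBall hq).add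
      ((HasDiscExpansion.of_hasFPowerSeriesOnBall hq').const_mul (-1))).congr (G := H)
      fun x _ => by simp only [H]; ring
    refine hexp.eq_center_of_hasDerivAt_zero (fun x hx hx0 => ?_) hh
    have hmem := mem_polylogDomain_of_norm_sub_lt_one ha (y := a + x) (by simpa using hx)
    have hder := (hF' _ hmem hx0).sub (hG' _ hmem hx0)
    rw [sub_self] at hder
    exact hder
  have hinv : ∀ z ∈ polylogDomain p, ∀ i, H (z ^ p ^ i) = H z := fun z hz i => by
    have := hconst z hz _ (Padic.norm_pow_pow_sub_self_lt_one hz.1 i)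
    simpa using this
  obtain ⟨P, hP, hPF⟩ := hF.frobenius
  obtain ⟨Q, hQ, hQG⟩ := hG.frobenius
  have hP1 := eval_one_ne_zero_of_forall_root_of_unity hP
  have hQ1 := eval_one_ne_zero_of_forall_root_of_unity hQ
  have hT : IsTateFunction fun z => P.eval 1 * Q.eval 1 * H z := by
    refine ((hPF.isTateFunction.frobeniusPoly Q).add
      ((hQG.isTateFunction.frobeniusPoly P).const_mul (-1))).congr fun z hz => ?_
    have h1 : ∀ z ∈ polylogDomain p, frobeniusPoly p Q H z = Q.eval 1 * H z :=
      fun z hz => frobeniusPoly_of_invariant Q (hinv z hz)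
    have h2 : frobeniusPoly p P (frobeniusPoly p Q H) z = P.eval 1 * frobeniusPoly p Q H z :=
      frobeniusPoly_of_invariant P fun i => by
        rw [h1 _ (pow_pow_mem_polylogDomain hz i), h1 z hz, hinv z hz]
    have h3 : frobeniusPoly p Q H = fun z => frobeniusPoly p Q F z - frobeniusPoly p Q G z :=
      funext fun z => frobeniusPoly_sub Q F G z
    rw [h1 z hz, h3, frobeniusPoly_sub, frobeniusPoly_comm P Q] at h2
    linear_combination h2
  intro z hz
  have h4 := hT.eq_apply_zero (fun x hx => by
    have := hconst 0 (mem_polylogDomain_of_norm_lt_one (by simp)) x hx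
    rw [zero_add] at this
    simp only [this]) hz
  have h5 : H 0 = 0 := by simp [H, h0]
  rw [h5, mul_zero] at h4
  exact sub_eq_zero.1 ((mul_eq_zero.1 h4).resolve_left (mul_ne_zero hP1 hQ1))

lemma IsPadicPolylog.eqOn {k : ℕ} {F G : ℚ_[p] → ℚ_[p]} (hF : IsPadicPolylog p k F)
    (hG : IsPadicPolylog p k G) : EqOn F G (polylogDomain p) := by
  induction k generalizing F G with
  | zero => exact fun z hz => (hF z hz).trans (hG z hz).symm
  | succ k ih =>
    obtain ⟨F₁, hF₁, hFC, hF0, hF'⟩ := hF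
    obtain ⟨G₁, hG₁, hGC, hG0, hG'⟩ := hG
    refine hFC.eqOn hGC (hF0.trans hG0.symm) hF' fun z hz hz0 => ?_
    rw [ih hF₁ hG₁ hz]
    exact hG' z hz hz0

end Uniqueness

/-! ### Teichmüller representatives -/

section Teichmuller

variable {p : ℕ} [Fact p.Prime]

/-- The representative is the limit of $a^{p^N}$. -/
lemma exists_pow_prime_eq_self {a : ℚ_[p]} (ha : ‖a‖ ≤ 1) :
    ∃ ζ : ℚ_[p], ζ ^ p = ζ ∧ ‖ζ - a‖ < 1 := by
  have ha' : ‖a ^ p‖ ≤ 1 := by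
    rw [norm_pow]
    exact pow_le_one₀ (norm_nonneg _) ha
  have hcauchy : CauchySeq fun N : ℕ => a ^ p ^ N := by
    refine NonarchimedeanAddGroup.cauchySeq_of_tendsto_sub_nhds_zero ?_
    refine (tendsto_pow_pow_sub_pow_pow ha' ha (Padic.norm_pow_sub_self_lt_one ha)).congr
      fun N => ?_
    rw [← pow_mul, ← pow_succ']
  obtain ⟨ζ, hζ⟩ := cauchySeq_tendsto_of_complete hcauchy
  refine ⟨ζ, ?_, ?_⟩
  · refine tendsto_nhds_unique (hζ.pow p) (((tendsto_add_atTop_iff_nat 1).2 hζ).congr fun N => ?_)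
    rw [← pow_mul, pow_succ]
  · obtain ⟨N, hN⟩ := (Metric.tendsto_atTop.1 hζ) 1 one_pos
    have h1 := hN N le_rfl
    rw [dist_eq_norm, norm_sub_rev] at h1
    have h2 : ζ - a = (ζ - a ^ p ^ N) + (a ^ p ^ N - a) := by ring
    rw [h2]
    exact (IsUltrametricDist.norm_add_le_max _ _).trans_lt
      (max_lt h1 (Padic.norm_pow_pow_sub_self_lt_one ha N))

lemma eq_of_pow_prime_eq_self {ζ η : ℚ_[p]} (hζ : ζ ^ p = ζ) (hη : η ^ p = η) (hζ1 : ‖ζ‖ ≤ 1)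
    (hη1 : ‖η‖ ≤ 1) (h : ‖ζ - η‖ < 1) : ζ = η := by
  have hpow {x : ℚ_[p]} (hx : x ^ p = x) (N : ℕ) : x ^ p ^ N = x := by
    induction N with
    | zero => simp
    | succ N ih => rw [pow_succ, pow_mul, ih, hx]
  have h1 := tendsto_pow_pow_sub_pow_pow hζ1 hη1 h
  simp only [hpow hζ, hpow hη] at h1
  exact sub_eq_zero.1 (tendsto_nhds_unique tendsto_const_nhds h1)

end Teichmuller

/-! ### Construction of the polylogarithms with their Frobenius relation -/

section Existence

variable {p : ℕ} [Fact p.Prime]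

/-- Since Frobenius fixes `ζ`, the polynomial $(\zeta+h)^p-\zeta$ in $h$ is integral without
constant term, so it maps the open unit disc to itself. -/
lemma hasDiscExpansion_comp_pow_prime {F : ℚ_[p] → ℚ_[p]} {ζ : ℚ_[p]} {c : ℕ → ℚ_[p]}
    (hF : HasDiscExpansion F ζ c) (hζ : ζ ^ p = ζ) (hζ1 : ‖ζ‖ ≤ 1) :
    ∃ d, HasDiscExpansion (fun z => F (z ^ p)) ζ d := by
  let Y : ℚ_[p][X] := (X + Polynomial.C ζ) ^ p - Polynomial.C ζ
  have hXC (m : ℕ) : ‖(X + Polynomial.C ζ : ℚ_[p][X]).coeff m‖ * 1 ^ m ≤ 1 := by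
    rw [coeff_add, coeff_X, Polynomial.coeff_C]
    rcases m with _ | _ | m <;> simp [hζ1]
  have hY (m : ℕ) : ‖Y.coeff m‖ ≤ 1 := by
    have h1 := norm_coeff_pow_mul_le zero_le_one zero_le_one hXC p m
    rw [one_pow, one_pow, mul_one] at h1
    rw [coeff_sub, sub_eq_add_neg]
    refine (IsUltrametricDist.norm_add_le_max _ _).trans (max_le h1 ?_)
    rw [norm_neg, Polynomial.coeff_C]
    split_ifs <;> simp [hζ1]
  have hY0 : ‖Y.coeff 0‖ < 1 := by
    rw [coeff_zero_eq_eval_zero]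
    simp [Y, hζ]
  have := hF.comp_polynomial (Q := X ^ p) (Y := Y) (b := ζ) hY hY0 fun h => by
    simp [Y, add_comm]
  exact ⟨_, by simpa using this⟩

lemma one_sub_inv_prime_pow_ne_zero (k : ℕ) : 1 - ((p : ℚ_[p]) ^ (k + 1))⁻¹ ≠ 0 := by
  intro h
  have h1 : ((p ^ (k + 1) : ℕ) : ℚ_[p]) = ((1 : ℕ) : ℚ_[p]) := by
    push_cast
    exact (inv_eq_one.1 (sub_eq_zero.1 h).symm)
  have h2 := Nat.cast_injective h1
  exact (Nat.one_lt_pow k.succ_ne_zero (Fact.out : p.Prime).one_lt).ne' h2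

/-- On the residue discs of `polylogDomain p`, the primitives of `G z / z` with prescribed values
at the Teichmüller representatives glue to a function that is analytic on every disc. -/
lemma exists_glued_primitive {G : ℚ_[p] → ℚ_[p]} (hG0 : G 0 = 0)
    (hG : ∀ a ∈ polylogDomain p, ∃ c, HasDiscExpansion G a c) (v : ℚ_[p] → ℚ_[p]) :
    ∃ F : ℚ_[p] → ℚ_[p], (∀ a ∈ polylogDomain p, ∃ c, HasDiscExpansion F a c) ∧
      (∀ ζ ∈ polylogDomain p, ζ ^ p = ζ → F ζ = v ζ) ∧
      ∀ z ∈ polylogDomain p, z ≠ 0 → HasDerivAt F (G z / z) z := by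
  have hloc (ζ : ℚ_[p]) : ∃ Φ : ℚ_[p] → ℚ_[p], ζ ∈ polylogDomain p → ζ ^ p = ζ →
      (∃ c, HasDiscExpansion Φ ζ c) ∧ Φ ζ = v ζ ∧
      ∀ h, ‖h‖ < 1 → ζ + h ≠ 0 → HasDerivAt Φ (G (ζ + h) / (ζ + h)) (ζ + h) := by
    by_cases hζ : ζ ∈ polylogDomain p ∧ ζ ^ p = ζ
    · obtain ⟨c, hc⟩ := hG ζ hζ.1
      -- The Teichmüller point of the disc of `0` is `0`, where `G 0 = 0` makes the division by `z`
      -- possible.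
      have hcase : ζ = 0 ∧ G 0 = 0 ∨ ‖ζ‖ = 1 := by
        refine (polylogDomain_norm_lt_or_eq hζ.1).imp_left fun h => ⟨?_, hG0⟩
        exact eq_of_pow_prime_eq_self hζ.2 (zero_pow (Fact.out : p.Prime).ne_zero) hζ.1.1 (by simp)
          (by simpa using h)
      obtain ⟨H, d, hd, hH⟩ := hc.exists_div_id hcase
      obtain ⟨Φ, e, he, hv, hder⟩ := hd.exists_primitive (v ζ)
      exact ⟨Φ, fun _ _ => ⟨⟨e, he⟩, hv, fun h hh hne => hH _ hne ▸ hder h hh⟩⟩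
    · exact ⟨0, fun h1 h2 => absurd ⟨h1, h2⟩ hζ⟩
  choose Φ hΦ using hloc
  have hteich (z : ℚ_[p]) : ∃ ζ : ℚ_[p], ‖z‖ ≤ 1 → ζ ^ p = ζ ∧ ‖ζ - z‖ < 1 := by
    by_cases hz : ‖z‖ ≤ 1
    · obtain ⟨ζ, h⟩ := exists_pow_prime_eq_self hz
      exact ⟨ζ, fun _ => h⟩
    · exact ⟨0, fun h => absurd h hz⟩
  choose τ hτ using hteich
  have hτmem {z : ℚ_[p]} (hz : z ∈ polylogDomain p) : τ z ∈ polylogDomain p :=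
    mem_polylogDomain_of_norm_sub_lt_one hz (hτ z hz.1).2
  -- `τ` is constant on residue discs, so `z ↦ Φ (τ z) z` coincides on each of them with a single
  -- primitive.
  have hτeq {ζ h : ℚ_[p]} (hζ : ζ ∈ polylogDomain p) (hζp : ζ ^ p = ζ) (hh : ‖h‖ < 1) :
      τ (ζ + h) = ζ := by
    have hmem := mem_polylogDomain_of_norm_sub_lt_one hζ (y := ζ + h) (by simpa using hh)
    obtain ⟨h1, h2⟩ := hτ _ hmem.1
    refine eq_of_pow_prime_eq_self h1 hζp (hτmem hmem).1 hζ.1 ?_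
    have h3 : τ (ζ + h) - ζ = (τ (ζ + h) - (ζ + h)) + h := by ring
    rw [h3]
    exact (IsUltrametricDist.norm_add_le_max _ _).trans_lt (max_lt h2 hh)
  have hF {ζ h : ℚ_[p]} (hζ : ζ ∈ polylogDomain p) (hζp : ζ ^ p = ζ) (hh : ‖h‖ < 1) :
      Φ (τ (ζ + h)) (ζ + h) = Φ ζ (ζ + h) := by
    rw [hτeq hζ hζp hh]
  have hsub {z : ℚ_[p]} (hz : z ∈ polylogDomain p) : ‖z - τ z‖ < 1 := by
    rw [norm_sub_rev]
    exact (hτ z hz.1).2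
  refine ⟨fun z => Φ (τ z) z, fun a ha => ?_, fun ζ hζ hζp => ?_, fun z hz hz0 => ?_⟩
  · obtain ⟨⟨c, hc⟩, -, -⟩ := hΦ (τ a) (hτmem ha) (hτ a ha.1).1
    have hc' : HasDiscExpansion (fun z => Φ (τ z) z) (τ a) c :=
      hc.congr fun h hh => (hF (hτmem ha) (hτ a ha.1).1 hh).symm
    exact ⟨_, hc'.recenter (hsub ha)⟩
  · have h1 := hF hζ hζp (h := 0) (by simp)
    rw [add_zero] at h1
    exact h1.trans (hΦ ζ hζ hζp).2.1
  · obtain ⟨-, -, hder⟩ := hΦ (τ z) (hτmem hz) (hτ z hz.1).1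
    have h1 := hder (z - τ z) (hsub hz) (by simpa using hz0)
    rw [add_sub_cancel] at h1
    refine h1.congr_of_eventuallyEq ?_
    filter_upwards [Metric.ball_mem_nhds z one_pos] with y hy
    rw [mem_ball_iff_norm] at hy
    have h2 : ‖y - τ z‖ < 1 := by
      have h3 : y - τ z = (y - z) + (z - τ z) := by ring
      rw [h3]
      exact (IsUltrametricDist.norm_add_le_max _ _).trans_lt (max_lt hy (hsub hz))
    have h4 := hF (hτmem hz) (hτ z hz.1).1 h2
    rwa [add_sub_cancel] at h4

lemma frobeniusPoly_one_sub_C_mul_X (c : ℚ_[p]) (F : ℚ_[p] → ℚ_[p]) (z : ℚ_[p]) :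
    frobeniusPoly p (1 - Polynomial.C c * X) F z = F z - c * F (z ^ p) := by
  rw [frobeniusPoly, sum_over_range' _ (fun i => zero_mul _) 2]
  · simp [Finset.sum_range_succ, Polynomial.coeff_one, Polynomial.coeff_X]
    ring
  · refine (natDegree_sub_le _ _).trans_lt ?_
    have := natDegree_C_mul_le c (X : ℚ_[p][X])
    rw [natDegree_X] at this
    simp only [natDegree_one]
    omega

lemma aeval_one_sub_C_mul_X_ne_zero (k : ℕ) {n : ℕ} (hn : 0 < n) {ζ : PadicAlgCl p}
    (hζ : ζ ^ n = 1) :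
    aeval ζ (1 - Polynomial.C ((p : ℚ_[p]) ^ (k + 1))⁻¹ * X : ℚ_[p][X]) ≠ 0 := by
  intro h
  have hp0 : (p : PadicAlgCl p) ≠ 0 := by exact_mod_cast (Fact.out : p.Prime).ne_zero
  simp only [map_sub, map_one, map_mul, aeval_C, aeval_X, map_inv₀, map_pow, map_natCast] at h
  have h1 : ζ = (p : PadicAlgCl p) ^ (k + 1) := by
    field_simp at h
    linear_combination -h
  rw [h1, ← pow_mul] at hζ
  have h2 : ((p ^ ((k + 1) * n) : ℕ) : PadicAlgCl p) = ((1 : ℕ) : PadicAlgCl p) := by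
    exact_mod_cast hζ
  exact (Nat.one_lt_pow (Nat.mul_pos k.succ_pos hn).ne' (Fact.out : p.Prime).one_lt).ne'
    (Nat.cast_injective h2)

lemma exists_hasDiscExpansion_div_one_sub {a : ℚ_[p]} (ha : a ∈ polylogDomain p) :
    ∃ c, HasDiscExpansion (fun z : ℚ_[p] => z / (1 - z)) a c := by
  obtain ⟨c, hc⟩ := exists_hasDiscExpansion_mahlerTransform (1 : C(ℤ_[p], ℚ_[p])) ha
  refine ⟨_, (hc.add (HasDiscExpansion.const (-1) a)).congr fun h hh => ?_⟩
  have hz := mem_polylogDomain_of_norm_sub_lt_one ha (y := a + h) (by simpa using hh)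
  have h0 := one_sub_ne_zero_of_mem hz
  rw [mahlerTransform_one hz, div_eq_mul_inv]
  linear_combination mul_inv_cancel₀ h0

/-- The chain rule for `z ^ m` produces a factor `m`. With `m = p` and $q=p^{-(k+1)}$ this turns $q$
into $p^{-k}$, the constant in the Frobenius relation of weight $k$. -/
lemma hasDerivAt_zero_of_frobenius {K : Type*} [NontriviallyNormedField K] {F l : K → K}
    {y q g g' : K} {m : ℕ} (hm : 1 ≤ m) (hy : y ≠ 0) (hF : HasDerivAt F (g / y) y)
    (hF' : HasDerivAt F (g' / y ^ m) (y ^ m)) (hl : HasDerivAt l ((g - q * m * g') / y) y) :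
    HasDerivAt (fun z => F z + (-q * F (z ^ m) + -1 * l z)) 0 y := by
  have h1 : HasDerivAt (fun z => F (z ^ m)) (g' / y ^ m * (m * y ^ (m - 1))) y :=
    HasDerivAt.comp y hF' (hasDerivAt_pow m y)
  have h2 := hF.add ((h1.const_mul (-q)).add (hl.const_mul (-1)))
  have hm' : y ^ m = y ^ (m - 1) * y := by rw [← pow_succ, Nat.sub_add_cancel hm]
  have h3 : g / y + (-q * (g' / y ^ m * (m * y ^ (m - 1))) + -1 * ((g - q * m * g') / y)) = 0 := by
    rw [hm']
    field_simp
    ring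
  rw [h3] at h2
  exact h2

/-- The Frobenius relation is carried through the induction: it yields overconvergence in each
weight, and later the values at Teichmüller points. -/
theorem exists_isPadicPolylog (hp2 : 2 < p) (k : ℕ) : ∃ F : ℚ_[p] → ℚ_[p],
    IsPadicPolylog p k F ∧ F 0 = 0 ∧ (∀ a ∈ polylogDomain p, ∃ c, HasDiscExpansion F a c) ∧
      ∀ z ∈ polylogDomain p,
        F z - ((p : ℚ_[p]) ^ k)⁻¹ * F (z ^ p) = mahlerTransform (unitInvPow p k) z := by
  induction k with
  | zero =>
    refine ⟨fun z => z / (1 - z), fun z _ => rfl, by simp,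
      fun a ha => exists_hasDiscExpansion_div_one_sub ha, fun z hz => ?_⟩
    rw [mahlerTransform_unitInvPow_zero hz]
    simp
  | succ k ih =>
    obtain ⟨G, hG, hG0, hGan, hGφ⟩ := ih
    set q : ℚ_[p] := ((p : ℚ_[p]) ^ (k + 1))⁻¹ with hq
    let l := mahlerTransform (unitInvPow p (k + 1))
    -- At `ζ ^ p = ζ` the desired relation reads `(1 - q) * F ζ = l ζ`, which forces these constants
    -- of integration.
    obtain ⟨F, hFan, hFv, hFd⟩ := exists_glued_primitive hG0 hGan fun ζ => (1 - q)⁻¹ * l ζ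
    have h0 : (0 : ℚ_[p]) ∈ polylogDomain p := mem_polylogDomain_of_norm_lt_one (by simp)
    have hp0 : (p : ℚ_[p]) ≠ 0 := by exact_mod_cast (Fact.out : p.Prime).ne_zero
    have hF0 : F 0 = 0 := by
      rw [hFv 0 h0 (zero_pow (Fact.out : p.Prime).ne_zero)]
      simp only [l, mahlerTransform_apply_zero]
      rw [unitInvPow_apply, unitInvPowFun_of_norm_ne_one (by simp), mul_zero]
    have hφ : ∀ z ∈ polylogDomain p, F z - q * F (z ^ p) = l z := by
      intro z hz
      obtain ⟨ζ, hζp, hζz⟩ := exists_pow_prime_eq_self hz.1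
      have hζ := mem_polylogDomain_of_norm_sub_lt_one hz hζz
      obtain ⟨c, hc⟩ := hFan ζ hζ
      obtain ⟨d, hd⟩ := hasDiscExpansion_comp_pow_prime hc hζp hζ.1
      obtain ⟨e, he⟩ := exists_hasDiscExpansion_mahlerTransform (unitInvPow p (k + 1)) hζ
      -- The defect of the Frobenius relation on the disc of `ζ`: its derivative vanishes away from
      -- `0`, and its value at `ζ` is zero.
      have hE := hc.add ((hd.const_mul (-q)).add (he.const_mul (-1)))
      have hconst := hE.eq_center_of_hasDerivAt_zero (fun h hh hne => ?_) (h := z - ζ)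
        (by rwa [norm_sub_rev])
      · have hcenter := hFv ζ hζ hζp
        rw [add_sub_cancel, hζp, hcenter] at hconst
        have h1 : (1 - q)⁻¹ * l ζ + (-q * ((1 - q)⁻¹ * l ζ) + -1 * l ζ) = 0 := by
          have := mul_inv_cancel₀ (one_sub_inv_prime_pow_ne_zero (p := p) k)
          rw [← hq] at this
          linear_combination (l ζ) * this
        change F z + (-q * F (z ^ p) + -1 * l z) =
          (1 - q)⁻¹ * l ζ + (-q * ((1 - q)⁻¹ * l ζ) + -1 * l ζ) at hconst
        rw [h1] at hconst
        linear_combination hconst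
      · have hy := mem_polylogDomain_of_norm_sub_lt_one hζ (y := ζ + h) (by simpa using hh)
        set y := ζ + h
        have hd1 := hFd y hy hne
        have hd2 := hFd (y ^ p) (pow_mem_polylogDomain hy) (pow_ne_zero _ hne)
        have hd3 := hasDerivAt_mahlerTransform (unitInvPow p (k + 1)) hy hne
        rw [mulId_unitInvPow, ← hGφ y hy] at hd3
        have hq' : q * p = ((p : ℚ_[p]) ^ k)⁻¹ := by
          rw [hq, pow_succ]
          field_simp
        rw [← hq'] at hd3
        exact hasDerivAt_zero_of_frobenius (Fact.out : p.Prime).one_le hne hd1 hd2 hd3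
    refine ⟨F, ⟨G, hG, ⟨fun a ha => ?_, ?_⟩, hF0, hFd⟩, hF0, hFan, hφ⟩
    · obtain ⟨c, hc⟩ := hFan a ha
      exact ⟨_, hc.hasFPowerSeriesOnBall⟩
    · refine ⟨1 - Polynomial.C q * X, fun n hn ζ hζ => aeval_one_sub_C_mul_X_ne_zero k hn hζ, ?_⟩
      refine (isOverconvergent_mahlerTransform_unitInvPow hp2 (k + 1)).congr fun z hz => ?_
      rw [frobeniusPoly_one_sub_C_mul_X, hφ z hz]

end Existence

/-! ### Zeros of the logarithm and of the transform -/

section Zeros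

variable {p : ℕ} [Fact p.Prime]

lemma sum_range_sq_mul_pow {R : Type*} [CommRing R] (x : R) (N : ℕ) :
    (x - 1) ^ 3 * ∑ n ∈ Finset.range N, (n : R) ^ 2 * x ^ n =
      x ^ N * ((N : R) ^ 2 * (x - 1) ^ 2 - 2 * N * x * (x - 1) + x * (x + 1)) - x * (x + 1) := by
  induction N with
  | zero => simp
  | succ N ih =>
    rw [Finset.sum_range_succ, mul_add, ih]
    push_cast
    ring

/-- With $p=0$ and $x^p=x$, the closed form reduces to $(x-1)x(x+1)$. -/
lemma ZMod.eq_neg_one_of_sum_sq_mul_pow_eq_zero {x : ZMod p} (hx0 : x ≠ 0) (hx1 : x ≠ 1)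
    (hx : ∑ n ∈ Finset.range p, (n : ZMod p) ^ 2 * x ^ n = 0) : x = -1 := by
  have h := sum_range_sq_mul_pow x p
  rw [hx, ZMod.pow_card, ZMod.natCast_self] at h
  have h1 : (x - 1) * x * (x + 1) = 0 := by linear_combination -h
  rcases mul_eq_zero.1 h1 with h2 | h2
  · rcases mul_eq_zero.1 h2 with h3 | h3
    · exact absurd (sub_eq_zero.1 h3) hx1
    · exact absurd h3 hx0
  · exact eq_neg_of_add_eq_zero_left h2

/-- Fermat's little theorem gives $n^{-(p-3)}\equiv n^2$ for units; for multiples of $p$ both terms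
vanish modulo $p$. -/
lemma norm_unitInvPow_sub_sq_lt_one (hp : 5 ≤ p) (n : ℕ) :
    ‖unitInvPow p (p - 3) n - (n : ℚ_[p]) ^ 2‖ < 1 := by
  rw [unitInvPow_apply]
  by_cases hn : ‖(n : ℤ_[p])‖ = 1
  · have hn' : ‖(n : ℚ_[p])‖ = 1 := by exact_mod_cast hn
    have hn0 : (n : ℚ_[p]) ≠ 0 := norm_ne_zero_iff.1 (by simp [hn'])
    rw [unitInvPowFun_of_norm_eq_one hn]
    have h1 : (((n : ℤ_[p]) : ℚ_[p]) ^ (p - 3))⁻¹ - (n : ℚ_[p]) ^ 2 =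
        -((n : ℚ_[p]) ^ (p - 2))⁻¹ * ((n : ℚ_[p]) ^ p - n) := by
      obtain ⟨m, hm⟩ := Nat.exists_eq_add_of_le' hp
      have e3 : p - 3 = m + 2 := by omega
      have e2 : p - 2 = m + 3 := by omega
      rw [e3, e2]
      rw [show (n : ℚ_[p]) ^ p = (n : ℚ_[p]) ^ (m + 5) by rw [← hm]]
      rw [PadicInt.coe_natCast]
      field_simp
      ring
    rw [h1, norm_mul, norm_neg, norm_inv, norm_pow, hn', one_pow, inv_one, one_mul]
    exact Padic.norm_pow_sub_self_lt_one hn'.le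
  · have hn' : ‖(n : ℚ_[p])‖ < 1 := by
      have := lt_of_le_of_ne (PadicInt.norm_le_one (n : ℤ_[p])) hn
      exact_mod_cast this
    rw [unitInvPowFun_of_norm_ne_one hn, zero_sub, norm_neg, norm_pow]
    exact pow_lt_one₀ (norm_nonneg _) hn' two_ne_zero

lemma norm_add_one_lt_one_of_mahlerTransform_eq_zero (hp : 5 ≤ p) {z : ℤ_[p]}
    (hz : z ∈ thricePuncturedLinePoints p)
    (h : mahlerTransform (unitInvPow p (p - 3)) z = 0) : ‖z + 1‖ < 1 := by
  have hzD : (z : ℚ_[p]) ∈ polylogDomain p :=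
    ⟨PadicInt.norm_le_one z, by exact_mod_cast PadicInt.isUnit_iff.1 hz.2⟩
  have h1 := norm_mahlerTransform_sub_sum_le (unitInvPow p (p - 3)) hzD p
  rw [h, mul_zero, zero_sub, norm_neg] at h1
  have h2 : ‖shiftMap (p : ℤ_[p]) (unitInvPow p (p - 3)) - unitInvPow p (p - 3)‖ < 1 := by
    refine lt_of_le_of_lt ((ContinuousMap.norm_le _ (norm_nonneg (p : ℤ_[p]))).2 fun x => ?_)
      ((PadicInt.norm_lt_one_iff_dvd _).2 dvd_rfl)
    have := norm_unitInvPowFun_sub_le (p - 3) (x + (p : ℤ_[p])) x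
    rwa [add_sub_cancel_left] at this
  have h3 : ‖∑ n ∈ Finset.range p, (n : ℚ_[p]) ^ 2 * (z : ℚ_[p]) ^ n‖ < 1 := by
    have e : ∑ n ∈ Finset.range p, (n : ℚ_[p]) ^ 2 * (z : ℚ_[p]) ^ n =
        ∑ n ∈ Finset.range p, unitInvPow p (p - 3) n * (z : ℚ_[p]) ^ n +
        ∑ n ∈ Finset.range p, -(unitInvPow p (p - 3) n - (n : ℚ_[p]) ^ 2) * (z : ℚ_[p]) ^ n := by
      rw [← Finset.sum_add_distrib]
      exact Finset.sum_congr rfl fun n _ => by ring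
    rw [e]
    refine (IsUltrametricDist.norm_add_le_max _ _).trans_lt (max_lt (h1.trans_lt h2) ?_)
    obtain ⟨n, -, hn⟩ := IsUltrametricDist.exists_norm_finsetSum_le (Finset.range p)
      fun n : ℕ => -(unitInvPow p (p - 3) n - (n : ℚ_[p]) ^ 2) * (z : ℚ_[p]) ^ n
    refine hn.trans_lt ?_
    rw [norm_mul, norm_neg, norm_pow]
    exact (mul_le_of_le_one_right (norm_nonneg _) (pow_le_one₀ (norm_nonneg _) hzD.1)).trans_lt
      (norm_unitInvPow_sub_sq_lt_one hp n)
  have h4 : ‖∑ n ∈ Finset.range p, (n : ℤ_[p]) ^ 2 * z ^ n‖ < 1 := by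
    have e : ((∑ n ∈ Finset.range p, (n : ℤ_[p]) ^ 2 * z ^ n : ℤ_[p]) : ℚ_[p]) =
        ∑ n ∈ Finset.range p, (n : ℚ_[p]) ^ 2 * (z : ℚ_[p]) ^ n := by
      simp
    rw [← e] at h3
    exact h3
  rw [PadicInt.norm_lt_one_iff_toZMod_eq_zero] at h4 ⊢
  rw [map_sum] at h4
  simp only [map_mul, map_pow, map_natCast] at h4
  have h5 : PadicInt.toZMod z ≠ 0 := by
    rw [Ne, ← PadicInt.norm_lt_one_iff_toZMod_eq_zero, PadicInt.isUnit_iff.1 hz.1]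
    exact lt_irrefl 1
  have h6 : PadicInt.toZMod z ≠ 1 := by
    intro h6
    have h7 : PadicInt.toZMod (1 - z) = 0 := by rw [map_sub, map_one, h6, sub_self]
    rw [← PadicInt.norm_lt_one_iff_toZMod_eq_zero, PadicInt.isUnit_iff.1 hz.2] at h7
    exact lt_irrefl 1 h7
  rw [map_add, map_one, ZMod.eq_neg_one_of_sum_sq_mul_pow_eq_zero h5 h6 h4, neg_add_cancel]

lemma Padic.norm_two_eq_one (hp : 2 < p) : ‖(2 : ℚ_[p])‖ = 1 := by
  have h := PadicInt.norm_lt_one_iff_toZMod_eq_zero (p := p) (x := 2)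
  have h2 : PadicInt.toZMod (2 : ℤ_[p]) ≠ 0 := by
    rw [map_ofNat]
    have : ((2 : ℕ) : ZMod p) ≠ 0 := by
      rw [Ne, ZMod.natCast_eq_zero_iff]
      exact fun hdvd => absurd (Nat.le_of_dvd two_pos hdvd) (by omega)
    exact_mod_cast this
  exact le_antisymm (PadicInt.norm_le_one (2 : ℤ_[p])) (not_lt.1 fun hlt => h2 (h.1 hlt))

lemma neg_one_mem_polylogDomain (hp : 2 < p) : (-1 : ℚ_[p]) ∈ polylogDomain p := by
  refine ⟨by simp, ?_⟩
  rw [sub_neg_eq_add, one_add_one_eq_two, Padic.norm_two_eq_one hp]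

lemma unitInvPow_neg {k : ℕ} (hk : Even k) (x : ℤ_[p]) :
    unitInvPow p k (-x) = unitInvPow p k x := by
  rw [unitInvPow_apply, unitInvPow_apply, unitInvPowFun, unitInvPowFun, norm_neg, PadicInt.coe_neg,
    hk.neg_pow]

/-- The transform of an even function that vanishes at `0` vanishes at `-1`. -/
lemma mahlerTransform_neg_one (hp : 2 < p) {f : C(ℤ_[p], ℚ_[p])} (hf0 : f 0 = 0)
    (hf : ∀ x, f (-x) = f x) : mahlerTransform f (-1) = 0 := by
  have hD := neg_one_mem_polylogDomain (p := p) hp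
  have hodd : Odd p := (Fact.out : p.Prime).odd_of_ne_two (by omega)
  refine tendsto_nhds_unique (tendsto_mahlerTransform f hD) ?_
  refine squeeze_zero_norm (fun N => ?_) (tendsto_norm_shiftMap_sub f)
  set P := p ^ N with hP
  have hPodd : Odd P := hodd.pow
  -- Because `f 0 = 0`, the index range can be moved to $1,\dots,P$ and then reflected by $n\mapsto
  -- P-n$. As $P$ is odd the sign flips, so evenness makes the sum equal to its negative up to
  -- errors bounded by the shift by $P$, and `2` is a unit.
  have h1 : ∑ n ∈ Finset.range P, f n * (-1) ^ n =
      ∑ n ∈ Finset.range P, f (n + 1 : ℕ) * (-1 : ℚ_[p]) ^ (n + 1) - f P * (-1) ^ P := by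
    have := Finset.sum_range_succ (fun n : ℕ => f n * (-1 : ℚ_[p]) ^ n) P
    rw [Finset.sum_range_succ'] at this
    simp only [Nat.cast_zero, hf0, zero_mul, add_zero] at this
    rw [this]
    ring
  have h2 : ∑ n ∈ Finset.range P, f (n + 1 : ℕ) * (-1 : ℚ_[p]) ^ (n + 1) =
      ∑ n ∈ Finset.range P, f (P - n : ℕ) * (-1 : ℚ_[p]) ^ (P - n) := by
    rw [← Finset.sum_range_reflect]
    refine Finset.sum_congr rfl fun n hn => ?_
    have : P - 1 - n + 1 = P - n := by have := Finset.mem_range.1 hn; omega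
    rw [this]
  have hshift (x : ℤ_[p]) : ‖f (x + (P : ℕ)) - f x‖ ≤ ‖shiftMap ((P : ℕ) : ℤ_[p]) f - f‖ :=
    (shiftMap ((P : ℕ) : ℤ_[p]) f - f).norm_coe_le_norm x
  have h3 : 2 * ∑ n ∈ Finset.range P, f n * (-1) ^ n =
      f P - ∑ n ∈ Finset.range P, (f (-n + (P : ℕ)) - f (-n)) * (-1) ^ n := by
    have h4 : ∑ n ∈ Finset.range P, f (P - n : ℕ) * (-1 : ℚ_[p]) ^ (P - n) =
        -∑ n ∈ Finset.range P, f (-n + (P : ℕ)) * (-1 : ℚ_[p]) ^ n := by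
      rw [← Finset.sum_neg_distrib]
      refine Finset.sum_congr rfl fun n hn => ?_
      have hn' := (Finset.mem_range.1 hn).le
      have h5 : (-1 : ℚ_[p]) ^ (P - n) = -(-1) ^ n := by
        have h6 : (-1 : ℚ_[p]) ^ (P - n) * (-1) ^ n = -1 := by
          rw [← pow_add, Nat.sub_add_cancel hn', hPodd.neg_one_pow]
        have h7 : ((-1 : ℚ_[p]) ^ n) * (-1) ^ n = 1 := by
          rw [← mul_pow]; simp
        linear_combination (-1) ^ n * h6 - (-1 : ℚ_[p]) ^ (P - n) * h7
      rw [h5, Nat.cast_sub hn', neg_add_eq_sub]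
      ring
    rw [two_mul]
    nth_rewrite 1 [h1]
    rw [h2, h4, hPodd.neg_one_pow]
    simp only [sub_mul, Finset.sum_sub_distrib, hf]
    ring
  have h4 : ‖∑ n ∈ Finset.range P, f n * (-1 : ℚ_[p]) ^ n‖ ≤
      ‖shiftMap ((P : ℕ) : ℤ_[p]) f - f‖ := by
    rw [← one_mul ‖∑ n ∈ Finset.range P, f n * (-1 : ℚ_[p]) ^ n‖, ← Padic.norm_two_eq_one hp,
      ← norm_mul, h3, sub_eq_add_neg]
    refine (IsUltrametricDist.norm_add_le_max _ _).trans (max_le ?_ ?_)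
    · simpa [hf0] using hshift 0
    · rw [norm_neg]
      refine IsUltrametricDist.norm_sum_le_of_forall_le_of_nonneg (norm_nonneg _) fun n _ => ?_
      simpa using hshift (-n)
  rw [norm_mul, norm_inv_one_sub (pow_pow_mem_polylogDomain hD N), one_mul]
  exact h4

/-- The linear term dominates: the value group gives $\|y\|\le1/p\le1/5$, so $\|y^n/n\|\le
n5^{-(n-1)}\|y\|\le\frac25\|y\|$ for $n\ge2$, with the constant attained at $n=2$. -/
lemma eq_zero_of_tsum_pow_div_eq_zero (hp : 5 ≤ p) {y : ℚ_[p]} (hy : ‖y‖ < 1)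
    (h : ∑' n : ℕ, y ^ (n + 1) / ((n : ℚ_[p]) + 1) = 0) : y = 0 := by
  have hyp : ‖y‖ ≤ (1 / 5 : ℝ) := by
    have h1 := (Padic.norm_le_pow_iff_norm_lt_pow_add_one y (-1)).2 (by simpa using hy)
    refine h1.trans ?_
    rw [zpow_neg_one, one_div]
    gcongr
    exact_mod_cast hp
  have hterm (n : ℕ) : ‖y ^ (n + 1 + 1) / (((n + 1 : ℕ) : ℚ_[p]) + 1)‖ ≤ 2 / 5 * ‖y‖ := by
    have h1 := HasDiscExpansion.norm_inv_natCast_le (p := p) (n + 1).succ_ne_zero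
    have h2 : ((n + 1).succ : ℝ) * (1 / 5) ^ (n + 1) ≤ 2 / 5 := by
      induction n with
      | zero => norm_num
      | succ n ih =>
        have := ih (HasDiscExpansion.norm_inv_natCast_le (p := p) (n + 1).succ_ne_zero)
        push_cast at this ⊢
        rw [pow_succ]
        have h3 : (0 : ℝ) ≤ (1 / 5) ^ (n + 1) := by positivity
        have h4 : (0 : ℝ) ≤ n := by positivity
        nlinarith [mul_nonneg h4 h3]
    rw [div_eq_mul_inv, norm_mul, norm_pow, ← Nat.cast_succ]
    calc ‖y‖ ^ (n + 1 + 1) * ‖(((n + 1).succ : ℕ) : ℚ_[p])⁻¹‖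
        ≤ ‖y‖ ^ (n + 1 + 1) * ((n + 1).succ : ℝ) := by gcongr
      _ = ((n + 1).succ : ℝ) * ‖y‖ ^ (n + 1) * ‖y‖ := by ring
      _ ≤ ((n + 1).succ : ℝ) * (1 / 5) ^ (n + 1) * ‖y‖ := by gcongr
      _ ≤ 2 / 5 * ‖y‖ := by gcongr
  have hsum : Summable fun n : ℕ => y ^ (n + 1) / ((n : ℚ_[p]) + 1) := by
    apply NonarchimedeanAddGroup.summable_of_tendsto_cofinite_zero
    rw [Nat.cofinite_eq_atTop]
    have h1 : Tendsto (fun n : ℕ => (((n + 1 : ℕ) : ℝ)) * ‖y‖ ^ (n + 1)) atTop (𝓝 0) :=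
      (tendsto_add_atTop_iff_nat (f := fun n : ℕ => (n : ℝ) * ‖y‖ ^ n) 1).2
        (tendsto_self_mul_const_pow_of_lt_one (norm_nonneg _) hy)
    refine squeeze_zero_norm (fun n => ?_) h1
    rw [div_eq_mul_inv, norm_mul, norm_pow, ← Nat.cast_succ, mul_comm]
    gcongr
    exact HasDiscExpansion.norm_inv_natCast_le n.succ_ne_zero
  rw [hsum.tsum_eq_zero_add] at h
  have h1 : ‖y‖ ≤ 2 / 5 * ‖y‖ := by
    have h2 : y = -∑' n : ℕ, y ^ (n + 1 + 1) / (((n + 1 : ℕ) : ℚ_[p]) + 1) := by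
      simp only [zero_add, pow_one, Nat.cast_zero, div_one] at h
      linear_combination h
    calc ‖y‖ = ‖∑' n : ℕ, y ^ (n + 1 + 1) / (((n + 1 : ℕ) : ℚ_[p]) + 1)‖ := by
          rw [← norm_neg (∑' n : ℕ, _), ← h2]
      _ ≤ _ := IsUltrametricDist.norm_tsum_le_of_forall_le hterm
  exact norm_le_zero_iff.1 (by linarith)

lemma pow_prime_eq_self_of_padicLogUnit_eq_zero (hp : 5 ≤ p) {z : ℚ_[p]} (hz : ‖z‖ = 1)
    (h : padicLogUnit p z = 0) : z ^ p = z := by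
  have hz0 : z ≠ 0 := norm_ne_zero_iff.1 (by simp [hz])
  have hpz : z ^ p = z ^ (p - 1) * z := by
    rw [← pow_succ, Nat.sub_add_cancel (Fact.out : p.Prime).one_le]
  have hp1 : (p : ℚ_[p]) - 1 ≠ 0 := by
    rw [sub_ne_zero]
    exact_mod_cast (Fact.out : p.Prime).one_lt.ne'
  rw [padicLogUnit, mul_eq_zero, neg_eq_zero] at h
  have h1 := eq_zero_of_tsum_pow_div_eq_zero hp (y := 1 - z ^ (p - 1)) ?_
    (h.resolve_left (inv_ne_zero hp1))
  · rw [hpz, ← sub_eq_zero.1 h1, one_mul]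
  · have h2 : 1 - z ^ (p - 1) = -(z ^ p - z) * z⁻¹ := by
      rw [hpz]
      field_simp
      ring
    rw [h2, norm_mul, norm_neg, norm_inv, hz, inv_one, mul_one]
    exact Padic.norm_pow_sub_self_lt_one hz.le

end Zeros

/-- The first conjunct says that the polylogarithm is well defined (it exists, and it is unique on
its domain); the second is the determination of the common zeroes. -/
theorem mainTheorem11 (p : ℕ) [Fact p.Prime] (hp : 5 ≤ p) :
    (IsPadicPolylog p (p - 3) (padicPolylog p (p - 3)) ∧
      ∀ F : ℚ_[p] → ℚ_[p], IsPadicPolylog p (p - 3) F →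
        EqOn F (padicPolylog p (p - 3)) (polylogDomain p)) ∧
    {z : ℤ_[p] | z ∈ thricePuncturedLinePoints p ∧
      padicLogUnit p (z : ℚ_[p]) = 0 ∧ padicPolylog p (p - 3) (z : ℚ_[p]) = 0} = {-1} := by
  have hp2 : 2 < p := by omega
  obtain ⟨F, hF, -, -, hFφ⟩ := exists_isPadicPolylog hp2 (p - 3)
  have hspec : IsPadicPolylog p (p - 3) (padicPolylog p (p - 3)) :=
    Classical.epsilon_spec (p := IsPadicPolylog p (p - 3)) ⟨F, hF⟩
  refine ⟨⟨hspec, fun F' hF' => hF'.eqOn hspec⟩, ?_⟩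
  -- At Teichmüller points the Frobenius relation determines the polylogarithm from the transform.
  have hfix {z : ℚ_[p]} (hz : z ∈ polylogDomain p) (hzp : z ^ p = z) :
      (1 - ((p : ℚ_[p]) ^ (p - 3))⁻¹) * padicPolylog p (p - 3) z =
        mahlerTransform (unitInvPow p (p - 3)) z := by
    rw [← hF.eqOn hspec hz, ← hFφ z hz, hzp]
    ring
  have hodd : Odd p := (Fact.out : p.Prime).odd_of_ne_two (by omega)
  have hD := neg_one_mem_polylogDomain hp2
  ext z
  constructor
  · rintro ⟨hz, hlog, hLi⟩
    have hz1 : ‖(z : ℚ_[p])‖ = 1 := PadicInt.isUnit_iff.1 hz.1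
    have hzD : (z : ℚ_[p]) ∈ polylogDomain p :=
      ⟨hz1.le, by exact_mod_cast PadicInt.isUnit_iff.1 hz.2⟩
    have hzp := pow_prime_eq_self_of_padicLogUnit_eq_zero hp hz1 hlog
    have h1 := hfix hzD hzp
    rw [hLi, mul_zero] at h1
    have h2 := norm_add_one_lt_one_of_mahlerTransform_eq_zero hp hz h1.symm
    -- Both `z` and `-1` are Teichmüller points, and they lie in the same residue disc.
    have h3 := eq_of_pow_prime_eq_self hzp hodd.neg_one_pow hz1.le hD.1
      (by rw [sub_neg_eq_add]; exact_mod_cast h2)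
    exact Subtype.ext (by simpa using h3)
  · rintro rfl
    have hcast : ((-1 : ℤ_[p]) : ℚ_[p]) = -1 := by simp
    have hne : 1 - ((p : ℚ_[p]) ^ (p - 3))⁻¹ ≠ 0 := by
      have := one_sub_inv_prime_pow_ne_zero (p := p) (p - 4)
      rwa [show p - 4 + 1 = p - 3 by omega] at this
    have heven : Even (p - 3) := by
      obtain ⟨m, hm⟩ := hodd
      exact ⟨m - 1, by omega⟩
    refine ⟨⟨isUnit_one.neg, ?_⟩, ?_, ?_⟩
    · rw [PadicInt.isUnit_iff]
      have := hD.2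
      rw [← hcast] at this
      exact_mod_cast this
    · have hpow : (-1 : ℚ_[p]) ^ (p - 1) = 1 := (Nat.Odd.sub_odd hodd odd_one).neg_one_pow
      rw [hcast, padicLogUnit, hpow]
      simp
    · rw [hcast]
      have h1 := hfix hD hodd.neg_one_pow
      rw [mahlerTransform_neg_one hp2 _ (unitInvPow_neg heven)] at h1
      · exact (mul_eq_zero.1 h1).resolve_left hne
      · rw [unitInvPow_apply, unitInvPowFun_of_norm_ne_one (by simp)]
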